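/- **Supercritical pitchfork for two pairs of equal masses.** Consider four bodies with masses $m_1=m_2=1$, $m_3=m_4=m$, total mass $M=2+2m$, and the unknowns $x=(\lambda_0,\mu,r_{12},r_{13},r_{14},r_{23},r_{24},r_{34})\in\mathbb R^8$. Put $$U=\sum_{i<j}\frac{m_im_j}{r_{ij}},\qquad I=\frac1M\sum_{i<j}m_im_jr_{ij}^2,\qquad V=U+\lambda_0(I-1)+\mu S,$$ where $S$ is the Cayley–Menger determinant $$S=\det\begin{pmatrix}0&1&1&1&1\\1&0&r_{12}^2&r_{13}^2&r_{14}^2\\1&r_{12}^2&0&r_{23}^2&r_{24}^2\\1&r_{13}^2&r_{23}^2&0&r_{34}^2\\1&r_{14}^2&r_{24}^2&r_{34}^2&0\end{pmatrix}.$$ Let $F(\cdot,m):\mathbb R^8\to\mathbb R^8$ be the polynomial map of the Dziobek equations, that is, the gradient of $V$ with denominators cleared: its components are $M\,\partial V/\partial\lambda_0$, $\partial V/\partial\mu$ and $M r_{ij}^2\,\partial V/\partial r_{ij}$, in the order of the unknowns. Let $DF$ be its Jacobian matrix in $x$ and $F_m$ its partial derivative in $m$. Let $R$ be the linear involution of $\mathbb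 R^8$ that exchanges $r_{13}\leftrightarrow r_{23}$ and $r_{14}\leftrightarrow r_{24}$. Below, a decimal number followed by "?" denotes the closed interval centred at that number whose radius is one unit in its last digit. (1) In the box $$\lambda_0\in 4.0585641815314330056739142?,\quad \mu\in 0.7731895057295255894879076?,\quad r_{12}\in 1.0130295438471170352477195?,$$ $$r_{13},r_{23}\in 0.57621036528654983921809171?,\quad r_{14},r_{24}\in 0.99527106304736638582196968?,$$ $$r_{34}\in 0.58204027784245088387823969?,\quad m\in 0.9922994477523853474498458?$$ there is exactly one pair $(\tilde x_*,\tilde m_*)$ with $r_{13}=r_{23}$, $r_{14}=r_{24}$, $F(\tilde x_*,\tilde m_*)=0$ and $\det DF(\tilde x_*,\tilde m_*)=0$. (2) At this point $0$ is a simple eigenvalue of $A=DF(\tilde x_*,\tilde m_*)$. There are vectors $v$ and $w$ that span the one-dimensional spaces $\ker A$ and $\ker A^T$, with $Rv=-v$, $Rw=-w$, normalized so that their $r_{24}$-components equal $1$; their $r_{13}$-components lie in $0.3503863414744728128369?$ and $1.0453646029495395551308?$ respectively. With all derivatives taken at $(\tilde x_*,\tilde m_*)$, $$w^TF_m=0,\qquad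 w^T[DF_m\,v]\in 27.1877227151147526097?\ (\text{so it is}\neq0),$$ $$w^T[D^2F(v,v)]=0,\qquad w^T[D^3F(v,v,v)]\in -2639.9736664601674948?\ (\text{so it is}<0).$$ (3) The equation $F(x,m)=0$ has a supercritical pitchfork bifurcation at $(\tilde x_*,\tilde m_*)$: there are an open neighbourhood $W$ of $\tilde x_*$, numbers $\varepsilon,\delta>0$, and smooth maps $s:(\tilde m_*-\varepsilon,\tilde m_*+\varepsilon)\to\mathbb R^8$, $X:(-\delta,\delta)\to\mathbb R^8$, $T:(-\delta,\delta)\to\mathbb R$ with $s(\tilde m_*)=X(0)=\tilde x_*$, $X'(0)\neq0$, $T(0)=\tilde m_*$, $T'(0)=0$, $T''(0)>0$, such that for $x\in W$ and $|m-\tilde m_*|<\varepsilon$ one has $F(x,m)=0$ if and only if $x=s(m)$ or $(x,m)=(X(y),T(y))$ for some $y\in(-\delta,\delta)$. Moreover $F(\cdot,m)$ has exactly one zero in $W$ for $\tilde m_*-\varepsilon<m\le\tilde m_*$ and exactly three for $\tilde m_*<m<\tilde m_*+\varepsilon$, so that three solutions merge into one as $m$ decreases to $\tilde m_*$. -/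

import Mathlib

open scoped ContDiff

noncomputable section

namespace Dziobek

/-- The unknowns `(λ₀, μ, r₁₂, r₁₃, r₁₄, r₂₃, r₂₄, r₃₄)`. -/
abbrev Vars := Fin 8 → ℝ

/-- The six mutual distances, in the order `12, 13, 14, 23, 24, 34`. -/
def mutualDist (x : Vars) (k : Fin 6) : ℝ := x k.succ.succ

/-- First index of the `k`-th pair. -/
def fstIdx : Fin 6 → Fin 4 := ![0, 0, 0, 1, 1, 2]

/-- Second index of the `k`-th pair. -/
def sndIdx : Fin 6 → Fin 4 := ![1, 2, 3, 2, 3, 3]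

/-- The product `mᵢ mⱼ` of the masses of the `k`-th pair. -/
def massProd (mass : Fin 4 → ℝ) (k : Fin 6) : ℝ := mass (fstIdx k) * mass (sndIdx k)

/-- The total mass `M`. -/
def totalMass (mass : Fin 4 → ℝ) : ℝ := ∑ i, mass i

/-- The Newtonian potential `U = ∑_{i<j} mᵢ mⱼ / rᵢⱼ`. -/
def potential (mass : Fin 4 → ℝ) (x : Vars) : ℝ := ∑ k, massProd mass k / mutualDist x k

/-- The moment of inertia `I = (1/M) ∑_{i<j} mᵢ mⱼ rᵢⱼ²`. -/
def inertia (mass : Fin 4 → ℝ) (x : Vars) : ℝ :=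
  (∑ k, massProd mass k * mutualDist x k ^ 2) / totalMass mass

/-- The Cayley–Menger determinant of the six distances. -/
def cayleyMenger (x : Vars) : ℝ :=
  Matrix.det !![0, 1,       1,       1,       1;
                1, 0,       x 2 ^ 2, x 3 ^ 2, x 4 ^ 2;
                1, x 2 ^ 2, 0,       x 5 ^ 2, x 6 ^ 2;
                1, x 3 ^ 2, x 5 ^ 2, 0,       x 7 ^ 2;
                1, x 4 ^ 2, x 6 ^ 2, x 7 ^ 2, 0]

/-- The partial derivative of a function of the eight unknowns in the `i`-th one. -/
def partialDeriv (f : Vars → ℝ) (i : Fin 8) (x : Vars) : ℝ :=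
  deriv (fun t => f (Function.update x i t)) (x i)

/-- The function `V = U + λ₀ (I - I₀) + μ S` with `I₀ = 1`, whose critical points are the strictly
planar central configurations. -/
def lagrangian (mass : Fin 4 → ℝ) (x : Vars) : ℝ :=
  potential mass x + x 0 * (inertia mass x - 1) + x 1 * cayleyMenger x

/-- The polynomial system obtained from `∂V/∂λ₀ = 0`, `∂V/∂μ = 0`, `∂V/∂rᵢⱼ = 0` by clearing
denominators: multiplication by `M`, by `1` and by `M rᵢⱼ²` respectively; see
`system_eq_partialDeriv`. -/
def system (mass : Fin 4 → ℝ) (x : Vars) : Fin 8 → ℝ :=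
  Matrix.vecCons ((∑ k, massProd mass k * mutualDist x k ^ 2) - totalMass mass)
    (Matrix.vecCons (cayleyMenger x) fun k : Fin 6 =>
      -(totalMass mass * massProd mass k) + 2 * x 0 * massProd mass k * mutualDist x k ^ 3
        + totalMass mass * x 1 * mutualDist x k ^ 2 * partialDeriv cayleyMenger k.succ.succ x)

theorem differentiable_cayleyMenger_update (i : Fin 8) (x : Vars) :
    Differentiable ℝ (fun t => cayleyMenger (Function.update x i t)) := by
  unfold cayleyMenger
  simp only [Matrix.det_apply]
  refine Differentiable.fun_sum fun σ _ => Differentiable.const_smul ?_ _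
  refine Differentiable.fun_finsetProd fun j _ => ?_
  have h : ∀ l : Fin 8, Differentiable ℝ (fun t : ℝ => Function.update x i t l) := by
    intro l
    by_cases hl : l = i
    · subst hl; simp [Function.update_self]
    · simp [Function.update_of_ne hl]
  generalize σ j = a
  fin_cases a <;> fin_cases j <;> simp <;> exact (h _).pow 2

/-- Away from collisions, `system` is the gradient of `V` with its denominators cleared. -/
theorem system_eq_partialDeriv (mass : Fin 4 → ℝ) (hM : totalMass mass ≠ 0) (x : Vars)
    (hx : ∀ k, mutualDist x k ≠ 0) :
    system mass x 0 = totalMass mass * partialDeriv (lagrangian mass) 0 x ∧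
    system mass x 1 = partialDeriv (lagrangian mass) 1 x ∧
    ∀ k : Fin 6, system mass x k.succ.succ =
      totalMass mass * mutualDist x k ^ 2 * partialDeriv (lagrangian mass) k.succ.succ x := by
  refine ⟨?_, ?_, fun k => ?_⟩
  · have h : (fun t => lagrangian mass (Function.update x 0 t)) = fun t =>
        potential mass x + t * (inertia mass x - 1) + x 1 * cayleyMenger x := by
      funext t
      simp [lagrangian, potential, inertia, cayleyMenger, mutualDist, Fin.succ_ne_zero]
    have h' : HasDerivAt (fun t => potential mass x + t * (inertia mass x - 1)
        + x 1 * cayleyMenger x) (1 * (inertia mass x - 1)) (x 0) :=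
      (((hasDerivAt_id (x 0)).mul_const _).const_add _).add_const _
    rw [partialDeriv, h, h'.deriv]
    simp only [system, inertia, Matrix.cons_val_zero]
    field_simp
  · have h : (fun t => lagrangian mass (Function.update x 1 t)) = fun t =>
        potential mass x + x 0 * (inertia mass x - 1) + t * cayleyMenger x := by
      funext t
      have h1 : ∀ k : Fin 6, (k.succ.succ : Fin 8) ≠ 1 := by decide
      simp [lagrangian, potential, inertia, cayleyMenger, mutualDist, Function.update_of_ne (h1 _)]
    have h' : HasDerivAt (fun t => potential mass x + x 0 * (inertia mass x - 1)
        + t * cayleyMenger x) (1 * cayleyMenger x) (x 1) :=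
      ((hasDerivAt_id (x 1)).mul_const _).const_add _
    rw [partialDeriv, h, h'.deriv]
    simp [system]
  · have h0 : (0 : Fin 8) ≠ k.succ.succ := (Fin.succ_ne_zero _).symm
    have h1 : (1 : Fin 8) ≠ k.succ.succ := by
      have : ∀ k : Fin 6, (1 : Fin 8) ≠ k.succ.succ := by decide
      exact this k
    have hd : ∀ (t : ℝ) (l : Fin 6),
        mutualDist (Function.update x k.succ.succ t) l
          = if l = k then t else mutualDist x l := by
      intro t l
      by_cases hl : l = k
      · subst hl; simp [mutualDist]
      · simp [mutualDist, hl, Function.update_of_ne]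
    have hU : HasDerivAt (fun t => potential mass (Function.update x k.succ.succ t))
        (-(massProd mass k) / mutualDist x k ^ 2) (x k.succ.succ) := by
      have : HasDerivAt (fun t => ∑ l, massProd mass l / (if l = k then t else mutualDist x l))
          (∑ l, if l = k then -(massProd mass k) / mutualDist x k ^ 2 else 0)
          (x k.succ.succ) := by
        refine HasDerivAt.fun_sum fun l _ => ?_
        by_cases hl : l = k
        · subst hl
          simp only [if_true]
          have := (hasDerivAt_inv (hx l)).const_mul (massProd mass l)
          simpa [div_eq_mul_inv, mutualDist] using this
        · simp only [hl, if_false]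
          exact hasDerivAt_const _ _
      simpa [potential, hd] using this
    have hI : HasDerivAt (fun t => inertia mass (Function.update x k.succ.succ t))
        (2 * massProd mass k * mutualDist x k / totalMass mass) (x k.succ.succ) := by
      have : HasDerivAt (fun t => ∑ l, massProd mass l * (if l = k then t else mutualDist x l) ^ 2)
          (∑ l, if l = k then 2 * massProd mass k * mutualDist x k else 0)
          (x k.succ.succ) := by
        refine HasDerivAt.fun_sum fun l _ => ?_
        by_cases hl : l = k
        · subst hl
          simp only [if_true]
          refine ((hasDerivAt_pow 2 (x l.succ.succ)).const_mul (massProd mass l)).congr_deriv ?_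
          simp only [mutualDist]
          push_cast
          ring
        · simp only [hl, if_false]
          exact hasDerivAt_const _ _
      simpa [inertia, hd] using this.div_const (totalMass mass)
    have hS : HasDerivAt (fun t => cayleyMenger (Function.update x k.succ.succ t))
        (partialDeriv cayleyMenger k.succ.succ x) (x k.succ.succ) :=
      (differentiable_cayleyMenger_update _ x _).hasDerivAt
    have hV := (hU.add ((hI.sub_const 1).const_mul (x 0))).add (hS.const_mul (x 1))
    have hL : (fun t => lagrangian mass (Function.update x k.succ.succ t)) = fun t =>
        potential mass (Function.update x k.succ.succ t)
          + x 0 * (inertia mass (Function.update x k.succ.succ t) - 1)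
          + x 1 * cayleyMenger (Function.update x k.succ.succ t) := by
      funext t
      simp [lagrangian, Function.update_of_ne h0, Function.update_of_ne h1]
    have hV' : partialDeriv (lagrangian mass) k.succ.succ x
        = -(massProd mass k) / mutualDist x k ^ 2
          + x 0 * (2 * massProd mass k * mutualDist x k / totalMass mass)
          + x 1 * partialDeriv cayleyMenger k.succ.succ x := by
      have hV'' := hV.deriv
      unfold partialDeriv at hV'' ⊢
      rw [hL]
      exact hV''
    rw [hV']
    have hk := hx k
    simp only [system, Matrix.cons_val_succ]
    field_simp

/-- The Dziobek equations `F(x, m) = 0` for the masses `m₁ = m₂ = 1`, `m₃ = m₄ = m`. -/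
def F (m : ℝ) (x : Vars) : Fin 8 → ℝ := system ![1, 1, m, m] x

/-- The Jacobian matrix `DF(x, m)` in the unknowns `x`. -/
def jacobian (m : ℝ) (x : Vars) : Matrix (Fin 8) (Fin 8) ℝ :=
  LinearMap.toMatrix' (fderiv ℝ (F m) x : Vars →ₗ[ℝ] Vars)

/-- The vector `F_m` of partial derivatives in the parameter `m`. -/
def paramDeriv (m : ℝ) (x : Vars) : Fin 8 → ℝ := deriv (fun m' => F m' x) m

/-- The action on the unknowns of the exchange of the bodies 1 and 2. -/
def swap12 (x : Vars) : Vars := ![x 0, x 1, x 2, x 5, x 6, x 3, x 4, x 7]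

/-- `(x, m)` solves the Dziobek equations, has `r₁₃ = r₂₃` and `r₁₄ = r₂₄`, and is singular. -/
structure IsSymmetricSingularSolution (m : ℝ) (x : Vars) : Prop where
  r13_eq_r23 : x 3 = x 5
  r14_eq_r24 : x 4 = x 6
  solution : F m x = 0
  singular : (jacobian m x).det = 0

/-- Midpoints of the intervals for the unknowns. -/
def center : Vars :=
  ![4.0585641815314330056739142, 0.7731895057295255894879076, 1.0130295438471170352477195,
    0.57621036528654983921809171, 0.99527106304736638582196968,
    0.57621036528654983921809171, 0.99527106304736638582196968,
    0.58204027784245088387823969]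

/-- Radii of these intervals: one unit in the last decimal place of the midpoint. -/
def radius : Vars :=
  ![1 / 10 ^ 25, 1 / 10 ^ 25, 1 / 10 ^ 25, 1 / 10 ^ 26, 1 / 10 ^ 26, 1 / 10 ^ 26, 1 / 10 ^ 26,
    1 / 10 ^ 26]

/-- The box of pairs `(x, m)` in which the bifurcation point is located. -/
def InBox (m : ℝ) (x : Vars) : Prop :=
  (∀ i, |x i - center i| ≤ radius i) ∧ |m - 0.9922994477523853474498458| ≤ 1 / 10 ^ 25

end Dziobek

/-- The family of equations `F μ x = 0` has a supercritical pitchfork bifurcation at `(x₀, μ₀)`.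
Near `(x₀, μ₀)` the solution set is the union of a smooth branch `x = s μ`, which passes through
the parameter value `μ₀`, and of a smooth curve `(X y, T y)`, which crosses it at `y = 0` in a
direction `(X' 0, 0)` with `X' 0 ≠ 0` and has a nondegenerate minimum of the parameter there. There
is one solution near `x₀` for `μ ≤ μ₀`, and there are three for `μ > μ₀`. -/
def IsSupercriticalPitchfork {E G : Type*} [NormedAddCommGroup E] [NormedSpace ℝ E] [Zero G]
    (F : ℝ → E → G) (μ₀ : ℝ) (x₀ : E) : Prop :=
  ∃ (U : Set E) (ε δ : ℝ) (s : ℝ → E) (X : ℝ → E) (T : ℝ → ℝ),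
    IsOpen U ∧ x₀ ∈ U ∧ 0 < ε ∧ 0 < δ ∧
    ContDiffOn ℝ ∞ s (Set.Ioo (μ₀ - ε) (μ₀ + ε)) ∧ s μ₀ = x₀ ∧
    ContDiffOn ℝ ∞ X (Set.Ioo (-δ) δ) ∧ X 0 = x₀ ∧ deriv X 0 ≠ 0 ∧
    ContDiffOn ℝ ∞ T (Set.Ioo (-δ) δ) ∧ T 0 = μ₀ ∧ deriv T 0 = 0 ∧ 0 < deriv (deriv T) 0 ∧
    (∀ μ ∈ Set.Ioo (μ₀ - ε) (μ₀ + ε), ∀ x ∈ U,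
      F μ x = 0 ↔ x = s μ ∨ ∃ y ∈ Set.Ioo (-δ) δ, x = X y ∧ μ = T y) ∧
    (∀ μ ∈ Set.Ioc (μ₀ - ε) μ₀, {x ∈ U | F μ x = 0}.ncard = 1) ∧
    (∀ μ ∈ Set.Ioo μ₀ (μ₀ + ε), {x ∈ U | F μ x = 0}.ncard = 3)

end

/-!
Displace a configuration that is symmetric under the exchange of the bodies 1 and 2 by `y` in the
antisymmetric direction with `r₁₃`-component `α` and `r₂₄`-component `1`. Since `F` commutes with
the exchange, its value splits into a symmetric part and `y` times an antisymmetric one, both of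
which are functions of `y²`. Their components are eight equations, the blown-up equations, for
`(λ₀, μ, r₁₂, r₁₃, r₁₄, r₃₄, α, m)` with the parameter `y²`. At `y² = 0` they express that the
symmetric configuration solves `F = 0` and that `α` is the slope of a kernel vector of `DF`. Hence
the bifurcation points in the box are their zeros at `y² = 0`, and interval arithmetic shows that a
fixed approximate inverse of the Jacobian matrix turns them into a perturbation of the identity near
an approximate zero, so that there is exactly one and it is nondegenerate.

By the implicit function theorem the zero continues to a curve parametrized by `y²`, which is the
branch `(X, T)`: its mass is an even function of `y`, and the pitchfork is supercritical because the
mass increases with `y²`. The symmetric equations alone continue the zero to the branch `s`. There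
are no other solutions: strict differentiability of `F` makes the slopes of the antisymmetric parts
of nearby solutions tend to `α`, so that asymmetric solutions solve the blown-up equations near the
zero. Expanding `F` in `y` expresses the coefficients of the normal form through the derivatives of
the blown-up equations.
-/

open scoped Topology

/-! ### Integer polynomial expressions -/

/-- Polynomial expressions with integer coefficients in variables indexed by `ι`. Unlike
`MvPolynomial ι ℤ` they can be evaluated in the kernel. -/
inductive PolyExpr (ι : Type*)
  | const : ℤ → PolyExpr ι
  | var : ι → PolyExpr ι
  | add : PolyExpr ι → PolyExpr ι → PolyExpr ι
  | mul : PolyExpr ι → PolyExpr ι → PolyExpr ι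

namespace PolyExpr

variable {ι κ : Type*}

/-- The value of an expression at a real point. -/
noncomputable def eval (z : ι → ℝ) : PolyExpr ι → ℝ
  | const k => k
  | var i => z i
  | add e f => eval z e + eval z f
  | mul e f => eval z e * eval z f

/-- Addition that drops vanishing summands, which keeps derivatives small. -/
def simpAdd : PolyExpr ι → PolyExpr ι → PolyExpr ι
  | const 0, f => f
  | e, const 0 => e
  | e, f => add e f

/-- Multiplication that drops trivial factors, which keeps derivatives small. -/
def simpMul : PolyExpr ι → PolyExpr ι → PolyExpr ι
  | const 0, _ => const 0
  | _, const 0 => const 0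
  | const 1, f => f
  | e, const 1 => e
  | e, f => mul e f

instance : Add (PolyExpr ι) := ⟨simpAdd⟩
instance : Mul (PolyExpr ι) := ⟨simpMul⟩
instance : Neg (PolyExpr ι) := ⟨fun e => const (-1) * e⟩
instance : Sub (PolyExpr ι) := ⟨fun e f => e + -f⟩

theorem neg_def (e : PolyExpr ι) : -e = const (-1) * e := rfl

theorem sub_def (e f : PolyExpr ι) : e - f = e + -f := rfl

@[simp] theorem eval_const (z : ι → ℝ) (k : ℤ) : (const k).eval z = k := rfl

@[simp] theorem eval_var (z : ι → ℝ) (i : ι) : (var i).eval z = z i := rfl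

@[simp] theorem eval_add (z : ι → ℝ) (e f : PolyExpr ι) :
    (e + f).eval z = e.eval z + f.eval z := by
  change (simpAdd e f).eval z = _
  unfold simpAdd
  split <;> simp [eval]

@[simp] theorem eval_mul (z : ι → ℝ) (e f : PolyExpr ι) :
    (e * f).eval z = e.eval z * f.eval z := by
  change (simpMul e f).eval z = _
  unfold simpMul
  split <;> simp [eval]

@[simp] theorem eval_neg (z : ι → ℝ) (e : PolyExpr ι) : (-e).eval z = -e.eval z := by
  simp [neg_def]

@[simp] theorem eval_sub (z : ι → ℝ) (e f : PolyExpr ι) :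
    (e - f).eval z = e.eval z - f.eval z := by
  simp [sub_def, sub_eq_add_neg]

theorem contDiff_eval [Fintype ι] (e : PolyExpr ι) {n : WithTop ℕ∞} :
    ContDiff ℝ n fun z : ι → ℝ => e.eval z := by
  induction e with
  | const k => exact contDiff_const
  | var i => exact contDiff_apply ℝ ℝ i
  | add e f he hf => exact he.add hf
  | mul e f he hf => exact he.mul hf

section Derivatives

variable [DecidableEq ι]

/-- The formal partial derivative. -/
def pderiv (i : ι) : PolyExpr ι → PolyExpr ι
  | const _ => const 0
  | var j => if i = j then const 1 else const 0
  | add e f => pderiv i e + pderiv i f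
  | mul e f => pderiv i e * f + e * pderiv i f

@[simp] theorem eval_pderiv_const (z : ι → ℝ) (i : ι) (k : ℤ) :
    (pderiv i (const k)).eval z = 0 := by
  simp [pderiv]

@[simp] theorem eval_pderiv_var (z : ι → ℝ) (i j : ι) :
    (pderiv i (var j)).eval z = if i = j then 1 else 0 := by
  simp [pderiv, apply_ite (eval z)]

@[simp] theorem eval_pderiv_add (z : ι → ℝ) (i : ι) (e f : PolyExpr ι) :
    (pderiv i (e + f)).eval z = (pderiv i e).eval z + (pderiv i f).eval z := by
  change (pderiv i (simpAdd e f)).eval z = _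
  unfold simpAdd
  split <;> simp [pderiv]

@[simp] theorem eval_pderiv_mul (z : ι → ℝ) (i : ι) (e f : PolyExpr ι) :
    (pderiv i (e * f)).eval z
      = (pderiv i e).eval z * f.eval z + e.eval z * (pderiv i f).eval z := by
  change (pderiv i (simpMul e f)).eval z = _
  unfold simpMul
  split <;> simp [pderiv]

@[simp] theorem eval_pderiv_neg (z : ι → ℝ) (i : ι) (e : PolyExpr ι) :
    (pderiv i (-e)).eval z = -(pderiv i e).eval z := by
  simp [neg_def]

@[simp] theorem eval_pderiv_sub (z : ι → ℝ) (i : ι) (e f : PolyExpr ι) :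
    (pderiv i (e - f)).eval z = (pderiv i e).eval z - (pderiv i f).eval z := by
  simp [sub_def, sub_eq_add_neg]

theorem hasDerivAt_eval_update (e : PolyExpr ι) (z : ι → ℝ) (i : ι) (t : ℝ) :
    HasDerivAt (fun t => e.eval (Function.update z i t))
      ((e.pderiv i).eval (Function.update z i t)) t := by
  induction e with
  | const k => simpa using hasDerivAt_const t (k : ℝ)
  | var j =>
    obtain rfl | hij := eq_or_ne i j
    · simpa using hasDerivAt_id' t
    · simpa [hij, hij.symm] using hasDerivAt_const t (z j)
  | add e f he hf =>
    simp only [pderiv, eval_add]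
    exact he.add hf
  | mul e f he hf =>
    simp only [pderiv, eval_add, eval_mul]
    exact he.mul hf

variable [Fintype ι]

/-- The differential of an expression, assembled from its formal partial derivatives. -/
noncomputable def differential (e : PolyExpr ι) (z : ι → ℝ) : (ι → ℝ) →L[ℝ] ℝ :=
  ∑ i, (e.pderiv i).eval z • ContinuousLinearMap.proj i

theorem differential_apply (e : PolyExpr ι) (z u : ι → ℝ) :
    e.differential z u = ∑ i, (e.pderiv i).eval z * u i := by
  simp [differential]

theorem hasStrictFDerivAt_eval (e : PolyExpr ι) (z : ι → ℝ) :
    HasStrictFDerivAt (fun z : ι → ℝ => e.eval z) (e.differential z) z := by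
  induction e with
  | const k =>
    refine (hasStrictFDerivAt_const (k : ℝ) z).congr_fderiv ?_
    ext u
    simp [differential_apply]
  | var i =>
    refine HasStrictFDerivAt.congr_fderiv
      (ContinuousLinearMap.proj (R := ℝ) (φ := fun _ : ι => ℝ) i).hasStrictFDerivAt ?_
    ext u
    simp [differential_apply]
  | add e f he hf =>
    refine (he.add hf).congr_fderiv ?_
    ext u
    simp [differential_apply, pderiv, add_mul, Finset.sum_add_distrib]
  | mul e f he hf =>
    refine (he.mul hf).congr_fderiv ?_
    ext u
    simp only [differential_apply, pderiv, eval_add, eval_mul, add_mul, Finset.sum_add_distrib,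
      add_apply, smul_apply, smul_eq_mul, Finset.mul_sum]
    rw [add_comm]
    congr 1 <;> exact Finset.sum_congr rfl fun i _ => by ring

end Derivatives

/-- Substitution of `(s i).1 + y * (s i).2` for the `i`-th variable, where `y` is a square root of
`q`; the result is given by its components with respect to `1` and `y`. -/
def split (s : ι → PolyExpr κ × PolyExpr κ) (q : PolyExpr κ) :
    PolyExpr ι → PolyExpr κ × PolyExpr κ
  | const k => (const k, const 0)
  | var i => s i
  | add e f => ((split s q e).1 + (split s q f).1, (split s q e).2 + (split s q f).2)
  | mul e f =>
    ((split s q e).1 * (split s q f).1 + q * ((split s q e).2 * (split s q f).2),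
      (split s q e).1 * (split s q f).2 + (split s q e).2 * (split s q f).1)

theorem eval_split (s : ι → PolyExpr κ × PolyExpr κ) (q : PolyExpr κ) (z : κ → ℝ) (y : ℝ)
    (hy : q.eval z = y ^ 2) (e : PolyExpr ι) :
    e.eval (fun i => (s i).1.eval z + y * (s i).2.eval z)
      = (split s q e).1.eval z + y * (split s q e).2.eval z := by
  induction e with
  | const k => simp [split]
  | var i => rfl
  | add e f he hf => simp only [eval, split, he, hf, eval_add]; ring
  | mul e f he hf => simp only [eval, split, he, hf, eval_add, eval_mul, hy]; ring

end PolyExpr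

/-! ### Ball arithmetic -/

theorem abs_sub_div_le_of_abs_mul_sub_mul_le {x c N β η : ℝ} (hN : 0 < N) (hβ : 0 < β)
    (hη : η ≤ β) (h : |(N * x - c) * β| ≤ η) : |x - c / N| ≤ 1 / N := by
  have scaled : |N * x - c| ≤ 1 := by
    rw [abs_mul, abs_of_pos hβ] at h
    exact le_of_mul_le_mul_right (by linarith) hβ
  rwa [← mul_div_cancel_left₀ x hN.ne', ← sub_div, abs_div, abs_of_pos hN,
    div_le_div_iff_of_pos_right hN]

/-- The denominator of fixed-point numbers. -/
def fixedScale : ℤ := 10 ^ 50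

theorem fixedScale_pos : 0 < fixedScale := by norm_num [fixedScale]

theorem fixedScale_cast_pos : (0 : ℝ) < fixedScale := Int.cast_pos.2 fixedScale_pos

/-- A ball of real numbers, given by its midpoint and its radius as multiples of
`1 / fixedScale`. -/
structure FixedBall where
  mid : ℤ
  rad : ℤ

namespace FixedBall

instance : Membership ℝ FixedBall := ⟨fun B x => |x * fixedScale - B.mid| ≤ B.rad⟩

instance : IntCast FixedBall := ⟨fun k => ⟨k * fixedScale, 0⟩⟩

instance : Add FixedBall := ⟨fun B C => ⟨B.mid + C.mid, B.rad + C.rad⟩⟩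

-- The summand `2` pays for rounding the midpoint and the radius down.
instance : Mul FixedBall := ⟨fun B C =>
  ⟨B.mid * C.mid / fixedScale,
    (|B.mid| * C.rad + B.rad * |C.mid| + B.rad * C.rad) / fixedScale + 2⟩⟩

variable {x y : ℝ} {B C : FixedBall}

theorem mem_def : x ∈ B ↔ |x * fixedScale - B.mid| ≤ B.rad := Iff.rfl

theorem intCast_mem (k : ℤ) : (k : ℝ) ∈ (k : FixedBall) := by
  change |(k : ℝ) * fixedScale - (k * fixedScale : ℤ)| ≤ (0 : ℤ)
  simp

theorem add_mem_add (hx : x ∈ B) (hy : y ∈ C) : x + y ∈ B + C := by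
  change |(x + y) * fixedScale - (B.mid + C.mid : ℤ)| ≤ (B.rad + C.rad : ℤ)
  push_cast
  rw [add_mul, add_sub_add_comm]
  exact (abs_add_le _ _).trans (add_le_add hx hy)

theorem floor_div_fixedScale (a : ℤ) : ⌊(a : ℝ) / fixedScale⌋ = a / fixedScale := by
  rw [Int.floor_div_cast_of_nonneg fixedScale_pos.le, Int.floor_intCast]

theorem mul_mem_mul (hx : x ∈ B) (hy : y ∈ C) : x * y ∈ B * C := by
  set N : ℝ := ((fixedScale : ℤ) : ℝ)
  have hN : 0 < N := fixedScale_cast_pos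
  set P : ℤ := B.mid * C.mid with hP
  set E : ℤ := |B.mid| * C.rad + B.rad * |C.mid| + B.rad * C.rad with hE
  have product_error : |x * y * N - P / N| ≤ E / N := by
    have expansion : x * y * N - P / N
        = (B.mid * (y * N - C.mid) + (x * N - B.mid) * C.mid
            + (x * N - B.mid) * (y * N - C.mid)) / N := by
      rw [hP]
      push_cast
      field_simp
      ring
    rw [expansion, abs_div, abs_of_pos hN, hE]
    push_cast
    gcongr
    rw [mem_def] at hx hy
    calc _ ≤ |B.mid * (y * N - C.mid)| + |(x * N - B.mid) * C.mid|
          + |(x * N - B.mid) * (y * N - C.mid)| := abs_add_three _ _ _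
      _ ≤ _ := by
        simp only [abs_mul]
        have := (abs_nonneg _).trans hx
        gcongr
  change |x * y * N - (P / fixedScale : ℤ)| ≤ (E / fixedScale + 2 : ℤ)
  push_cast
  rw [← floor_div_fixedScale, ← floor_div_fixedScale]
  rw [abs_le] at product_error ⊢
  constructor <;> linarith [Int.floor_le ((P : ℝ) / N), Int.lt_floor_add_one ((P : ℝ) / N),
    Int.lt_floor_add_one ((E : ℝ) / N)]

/-- The numbers of the ball, multiplied by `b`, differ from `t` by at most `η`. -/
def Within (B : FixedBall) (b t η : ℤ) : Prop :=
  |B.mid * b - t * fixedScale| + B.rad * b ≤ η * fixedScale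

instance (B : FixedBall) (b t η : ℤ) : Decidable (B.Within b t η) :=
  inferInstanceAs (Decidable (_ ≤ _))

theorem Within.abs_mul_sub_le {b t η : ℤ} (h : B.Within b t η) (hb : 0 < b) (hx : x ∈ B) :
    |x * b - t| ≤ η := by
  have hN : (0 : ℝ) < fixedScale := fixedScale_cast_pos
  have hb' : (0 : ℝ) < b := Int.cast_pos.2 hb
  have h' : |(B.mid : ℝ) * b - t * fixedScale| + B.rad * b ≤ η * fixedScale := by
    exact_mod_cast h
  refine le_of_mul_le_mul_right ?_ hN
  calc |x * b - t| * fixedScale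
      = |(x * fixedScale - B.mid) * b + (B.mid * b - t * fixedScale)| := by
        rw [← abs_of_pos hN, ← abs_mul, abs_of_pos hN]
        congr 1
        ring
    _ ≤ |x * fixedScale - B.mid| * b + |(B.mid : ℝ) * b - t * fixedScale| := by
        refine (abs_add_le _ _).trans ?_
        rw [abs_mul, abs_of_pos hb']
    _ ≤ B.rad * b + |(B.mid : ℝ) * b - t * fixedScale| := by
        gcongr
        exact mem_def.1 hx
    _ ≤ η * fixedScale := by linarith

end FixedBall

namespace PolyExpr

variable {ι : Type*}

/-- An enclosure of the values of an expression on a product of balls. -/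
def enclosure (B : ι → FixedBall) : PolyExpr ι → FixedBall
  | const k => k
  | var i => B i
  | add e f => enclosure B e + enclosure B f
  | mul e f => enclosure B e * enclosure B f

theorem eval_mem_enclosure {B : ι → FixedBall} {z : ι → ℝ} (hz : ∀ i, z i ∈ B i)
    (e : PolyExpr ι) : e.eval z ∈ e.enclosure B := by
  induction e with
  | const k => exact FixedBall.intCast_mem k
  | var i => exact hz i
  | add e f he hf => exact FixedBall.add_mem_add he hf
  | mul e f he hf => exact FixedBall.mul_mem_mul he hf

end PolyExpr

/-! ### Approximate inverses -/

section ApproximateInverse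

open scoped Matrix.Norms.Operator

theorem abs_dotProduct_sub_le {ι : Type*} [Fintype ι] {x t : ι → ℝ} {η : ℝ}
    (h : ∀ k, |x k - t k| ≤ η) (c : ι → ℝ) : |c ⬝ᵥ x - c ⬝ᵥ t| ≤ (∑ k, |c k|) * η := by
  rw [← dotProduct_sub, dotProduct, Finset.sum_mul]
  refine (Finset.abs_sum_le_sum_abs _ _).trans (Finset.sum_le_sum fun k _ => ?_)
  rw [abs_mul]
  exact mul_le_mul_of_nonneg_left (h k) (abs_nonneg _)

theorem norm_matrix_le_of_forall_sum_abs_le {m n : Type*} [Fintype m] [Fintype n]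
    {A : Matrix m n ℝ} {r : ℝ} (hr : 0 ≤ r) (h : ∀ i, ∑ j, |A i j| ≤ r) : ‖A‖ ≤ r := by
  lift r to NNReal using hr
  rw [Matrix.linfty_opNorm_def, NNReal.coe_le_coe, Finset.sup_le_iff]
  intro i _
  rw [← NNReal.coe_le_coe, NNReal.coe_sum]
  exact h i

variable {n : Type*} [Fintype n] [DecidableEq n]

/-- The matrix `J` is enclosed by `(T ± η) / b`, and its approximate left inverse is `c / a`. -/
theorem norm_one_sub_smul_mul_le {c T : Matrix n n ℤ} {a b η N : ℤ} (ha : 0 < a) (hb : 0 < b)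
    (hN : 0 < N)
    (hcert : ∀ i, N * ∑ j, (|((a * b) • (1 : Matrix n n ℤ) - c * T) i j| + (∑ k, |c i k|) * η)
      ≤ a * b)
    {J : Matrix n n ℝ} (hJ : ∀ k j, |J k j * b - T k j| ≤ η) :
    ‖1 - ((a : ℝ)⁻¹ • c.map (Int.cast : ℤ → ℝ)) * J‖ ≤ 1 / N := by
  have hab : (0 : ℝ) < a * b := by positivity
  have entry : ∀ i j, |(1 - ((a : ℝ)⁻¹ • c.map (Int.cast : ℤ → ℝ)) * J) i j| * (a * b)
      ≤ |(((a * b) • (1 : Matrix n n ℤ) - c * T) i j : ℝ)| + (∑ k, |(c i k : ℝ)|) * η := by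
    intro i j
    have split_error : (1 - ((a : ℝ)⁻¹ • c.map (Int.cast : ℤ → ℝ)) * J) i j * (a * b)
        = (((a * b) • (1 : Matrix n n ℤ) - c * T) i j : ℝ)
          - ((fun k => (c i k : ℝ)) ⬝ᵥ (fun k => J k j * b)
            - (fun k => (c i k : ℝ)) ⬝ᵥ fun k => (T k j : ℝ)) := by
      have ha' : (a : ℝ) ≠ 0 := by positivity
      simp only [Matrix.sub_apply, Matrix.smul_mul, Matrix.smul_apply, Matrix.mul_apply,
        Matrix.map_apply, Matrix.one_apply, dotProduct, smul_eq_mul, ← mul_assoc,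
        ← Finset.sum_mul]
      push_cast
      field_simp
      ring
    rw [← abs_of_pos hab, ← abs_mul, split_error]
    exact (abs_sub _ _).trans (add_le_add_right (abs_dotProduct_sub_le (fun k => hJ k j) _) _)
  refine norm_matrix_le_of_forall_sum_abs_le (by positivity) fun i => ?_
  have hN' : (0 : ℝ) < N := by positivity
  have hcert' := (Int.cast_le (R := ℝ)).2 (hcert i)
  push_cast at hcert'
  rw [le_div_iff₀ hN', ← mul_le_mul_iff_left₀ hab, one_mul, mul_right_comm, mul_comm,
    Finset.sum_mul]
  exact (mul_le_mul_of_nonneg_left (Finset.sum_le_sum fun j _ => entry i j) hN'.le).trans hcert'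

theorem isUnit_and_isUnit_of_norm_one_sub_mul_lt_one {C J : Matrix n n ℝ} (h : ‖1 - C * J‖ < 1) :
    IsUnit C ∧ IsUnit J := by
  have hCJ : IsUnit (C * J) := by simpa using isUnit_one_sub_of_norm_lt_one h
  rw [Matrix.isUnit_iff_isUnit_det, Matrix.det_mul, IsUnit.mul_iff] at hCJ
  simpa only [Matrix.isUnit_iff_isUnit_det] using hCJ

end ApproximateInverse

theorem injOn_and_exists_zero_of_norm_one_sub_fderiv_le {E : Type*} [NormedAddCommGroup E]
    [NormedSpace ℝ E] [CompleteSpace E] {g : E → E} {g' : E → E →L[ℝ] E} {z₀ : E} {r ρ : ℝ}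
    {c : NNReal} (hc : c < 1) (hg : ∀ z ∈ Metric.closedBall z₀ ρ, HasFDerivAt g (g' z) z)
    (hg' : ∀ z ∈ Metric.closedBall z₀ ρ, ‖1 - g' z‖ ≤ c) (hr0 : 0 ≤ r)
    (hr : ‖g z₀‖ ≤ (1 - c) * r) (hrρ : r ≤ ρ) :
    Set.InjOn g (Metric.closedBall z₀ ρ) ∧ ∃ z ∈ Metric.closedBall z₀ r, g z = 0 := by
  have approx : ApproximatesLinearOn g (ContinuousLinearEquiv.refl ℝ E : E →L[ℝ] E)
      (Metric.closedBall z₀ ρ) c := fun x hx y hy =>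
    Convex.norm_image_sub_le_of_norm_hasFDerivWithin_le' (fun z hz => (hg z hz).hasFDerivWithinAt)
      (fun z hz => (norm_sub_rev _ _).trans_le (hg' z hz)) (convex_closedBall z₀ ρ) hy hx
  constructor
  · intro x hx y hy hxy
    have contraction : ‖x - y‖ ≤ c * ‖x - y‖ := by simpa [hxy, norm_sub_rev] using approx x hx y hy
    have gap : 0 < 1 - (c : ℝ) := sub_pos.2 hc
    refine sub_eq_zero.1 (norm_le_zero_iff.1 (nonpos_of_mul_nonpos_right ?_ gap))
    linarith
  · have surj := approx.surjOn_closedBall_of_nonlinearRightInverse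
      { toFun := id, nnnorm := 1, bound' := fun y => by simp, right_inv' := fun y => rfl }
      hr0 (Metric.closedBall_subset_closedBall hrρ)
    exact surj (by simpa using hr)

/-! ### Simple eigenvalues -/

section SimpleEigenvalue

variable {K n : Type*} [Field K] [Fintype n] {A : Matrix n n K} {v w : n → K}

open scoped Matrix in
theorem rootMultiplicity_charpoly_zero_eq_one_of_dotProduct_ne_zero [DecidableEq n]
    (hv : LinearMap.ker A.mulVecLin = Submodule.span K {v}) (hw : w ᵥ* A = 0) (hwv : w ⬝ᵥ v ≠ 0) :
    A.charpoly.rootMultiplicity 0 = 1 := by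
  have hv0 : v ≠ 0 := by rintro rfl; simp at hwv
  have ker_sq : LinearMap.ker (A.mulVecLin ^ 1) = LinearMap.ker (A.mulVecLin ^ 2) := by
    refine le_antisymm (fun x hx => ?_) fun x hx => ?_
    · simpa [pow_two] using congrArg A.mulVecLin hx
    · obtain ⟨t, ht⟩ := Submodule.mem_span_singleton.1 <| hv ▸ (LinearMap.mem_ker.2 <|
        show A.mulVecLin (A.mulVecLin x) = 0 by simpa [pow_two] using hx)
      have tv : t * w ⬝ᵥ v = 0 := by
        rw [← smul_eq_mul, ← dotProduct_smul, ht, Matrix.mulVecLin_apply,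
          Matrix.dotProduct_mulVec, hw, zero_dotProduct]
      rw [(mul_eq_zero.1 tv).resolve_right hwv, zero_smul] at ht
      simpa using ht.symm
  have maxGen : Module.End.maxGenEigenspace A.mulVecLin 0 = Submodule.span K {v} := by
    ext x
    rw [Module.End.mem_maxGenEigenspace, ← hv]
    simp only [zero_smul, sub_zero]
    refine ⟨fun ⟨k, hk⟩ => ?_, fun hx => ⟨1, by simpa using hx⟩⟩
    have hk' : x ∈ LinearMap.ker (A.mulVecLin ^ (1 + k)) := by
      rw [LinearMap.mem_ker, pow_add, Module.End.mul_apply, hk, map_zero]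
    rw [← Module.End.ker_pow_constant ker_sq] at hk'
    simpa using hk'
  rw [← Matrix.charpoly_mulVecLin, ← LinearMap.finrank_maxGenEigenspace_eq, maxGen,
    finrank_span_singleton hv0]

theorem ker_mulVecLin_transpose_eq_span (hv0 : v ≠ 0) (hw0 : w ≠ 0)
    (hv : LinearMap.ker A.mulVecLin = Submodule.span K {v}) (hw : A.transpose.mulVec w = 0) :
    LinearMap.ker A.transpose.mulVecLin = Submodule.span K {w} := by
  have hle : Submodule.span K {w} ≤ LinearMap.ker A.transpose.mulVecLin := by
    rwa [Submodule.span_singleton_le_iff_mem]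
  refine (Submodule.eq_of_le_of_finrank_eq hle ?_).symm
  have h1 := A.mulVecLin.finrank_range_add_finrank_ker
  have h2 := A.transpose.mulVecLin.finrank_range_add_finrank_ker
  have h3 : A.transpose.rank = A.rank := A.rank_transpose
  rw [Matrix.rank, Matrix.rank] at h3
  rw [hv, finrank_span_singleton hv0] at h1
  rw [finrank_span_singleton hw0]
  omega

end SimpleEigenvalue

theorem iteratedFDeriv_apply_const {E G : Type*} [NormedAddCommGroup E] [NormedSpace ℝ E]
    [NormedAddCommGroup G] [NormedSpace ℝ G] {f : E → G} {k : ℕ} (hf : ContDiff ℝ k f) (x v : E) :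
    iteratedFDeriv ℝ k f x (fun _ => v) = iteratedDeriv k (fun t : ℝ => f (x + t • v)) 0 := by
  have line : (fun t : ℝ => f (x + t • v))
      = (fun z => f (x + z)) ∘ ContinuousLinearMap.toSpanSingleton ℝ v := by
    funext t
    simp
  rw [iteratedDeriv_eq_iteratedFDeriv, line,
    (ContinuousLinearMap.toSpanSingleton ℝ v).iteratedFDeriv_comp_right
      (f := fun z => f (x + z)) (by fun_prop) 0 le_rfl,
    ContinuousMultilinearMap.compContinuousLinearMap_apply, iteratedFDeriv_comp_add_left]
  simp

theorem exists_implicit_branch {E : Type*} [NormedAddCommGroup E] [NormedSpace ℝ E]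
    [FiniteDimensional ℝ E] {f : ℝ × E → E} {n : WithTop ℕ∞} (hn : n ≠ 0) {t₀ : ℝ} {u₀ : E}
    (hf : ContDiffAt ℝ n f (t₀, u₀)) (h0 : f (t₀, u₀) = 0) {f' : E →L[ℝ] E}
    (h : HasFDerivAt (fun u => f (t₀, u)) f' u₀) (hinj : Function.Injective f') :
    ∃ φ : ℝ → E, ContDiffAt ℝ n φ t₀ ∧ φ t₀ = u₀ ∧
      ∀ᶠ p in 𝓝 (t₀, u₀), f p = 0 ↔ φ p.1 = p.2 := by
  have : CompleteSpace E := FiniteDimensional.complete ℝ E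
  have hd : fderiv ℝ f (t₀, u₀) ∘L .inr ℝ ℝ E = f' :=
    ((hf.differentiableAt hn).hasFDerivAt.comp u₀ (hasFDerivAt_prodMk_right t₀ u₀)).unique h
  have hi : (fderiv ℝ f (t₀, u₀) ∘L .inr ℝ ℝ E).IsInvertible :=
    hd ▸ ⟨(LinearEquiv.ofInjectiveEndo (f' : E →ₗ[ℝ] E) hinj).toContinuousLinearEquiv, rfl⟩
  exact ⟨hf.implicitFunction hn hi, hf.contDiffAt_implicitFunction hn hi,
    hf.implicitFunction_apply_self hn hi,
    by simpa only [h0] using hf.eventually_apply_eq_iff_implicitFunction hn hi⟩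

theorem eventually_apply_graph_eq_zero {α β γ : Type*} [TopologicalSpace α] [TopologicalSpace β]
    [Zero γ] {f : α × β → γ} {φ : α → β} {t₀ : α} (hφ : ContinuousAt φ t₀)
    (h : ∀ᶠ p in 𝓝 (t₀, φ t₀), f p = 0 ↔ φ p.1 = p.2) : ∀ᶠ t in 𝓝 t₀, f (t, φ t) = 0 :=
  ((continuousAt_id.prodMk hφ).eventually h).mono fun _ ht => ht.2 rfl

/-! ### Pitchforks from two branches -/

theorem deriv_zero_of_eventually_even {T : ℝ → ℝ} (hT : ∀ᶠ y in 𝓝 0, T (-y) = T y) :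
    deriv T 0 = 0 := by
  have h := Filter.EventuallyEq.deriv_eq hT
  rw [deriv_comp_neg, neg_zero] at h
  linarith

theorem exists_strictMonoOn_Ico_of_deriv_deriv_pos {T : ℝ → ℝ} (hT : ∀ᶠ y in 𝓝 0, ContinuousAt T y)
    (hT' : deriv T 0 = 0) (hT'' : 0 < deriv (deriv T) 0) :
    ∃ δ > 0, StrictMonoOn T (Set.Ico 0 δ) := by
  obtain ⟨δ, hδ, h⟩ := Metric.eventually_nhds_iff.1
    (hT.and (eventually_nhdsWithin_sign_eq_of_deriv_pos hT'' hT'))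
  simp only [Real.dist_eq, sub_zero] at h
  refine ⟨δ, hδ, strictMonoOn_of_deriv_pos (convex_Ico 0 δ) (fun y hy => ?_) fun y hy => ?_⟩
  · exact (h ((abs_of_nonneg hy.1).trans_lt hy.2)).1.continuousWithinAt
  · rw [interior_Ico] at hy
    have sign_eq := (h ((abs_of_pos hy.1).trans_lt hy.2)).2
    rwa [sign_pos hy.1, sign_eq_one_iff] at sign_eq

/-- The configuration of a pitchfork on the window `(μ₀ - ε, μ₀ + ε) × U`: the zeros of `F` are the
trunk `s` and the prongs `(X y, T y)`, where `T` is even and increasing in `|y|`, and the functional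
`l` vanishes on the trunk and reads off the parameter `y` on the prongs. -/
structure TrunkAndProngs {E G : Type*} [Zero G] (F : ℝ → E → G) (l : E → ℝ) (s X : ℝ → E)
    (T : ℝ → ℝ) (U : Set E) (μ₀ ε δ : ℝ) : Prop where
  s_mem : ∀ μ ∈ Set.Ioo (μ₀ - ε) (μ₀ + ε), s μ ∈ U
  l_s : ∀ μ ∈ Set.Ioo (μ₀ - ε) (μ₀ + ε), l (s μ) = 0
  l_X : ∀ y ∈ Set.Ioo (-δ) δ, l (X y) = y
  X_zero : X 0 = s μ₀
  T_zero : T 0 = μ₀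
  T_neg : ∀ y ∈ Set.Ioo (-δ) δ, T (-y) = T y
  strictMonoOn_T : StrictMonoOn T (Set.Ico 0 δ)
  exists_prongs : ∀ μ ∈ Set.Ioo μ₀ (μ₀ + ε), ∃ y ∈ Set.Ioo 0 δ, T y = μ ∧ X y ∈ U ∧ X (-y) ∈ U
  zero_iff : ∀ μ ∈ Set.Ioo (μ₀ - ε) (μ₀ + ε), ∀ x ∈ U,
    F μ x = 0 ↔ x = s μ ∨ ∃ y ∈ Set.Ioo (-δ) δ, x = X y ∧ μ = T y

namespace TrunkAndProngs

variable {E G : Type*} [Zero G] {F : ℝ → E → G} {l : E → ℝ} {s X : ℝ → E} {T : ℝ → ℝ}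
  {U : Set E} {μ₀ ε δ : ℝ}

theorem T_abs (h : TrunkAndProngs F l s X T U μ₀ ε δ) {y : ℝ} (hy : y ∈ Set.Ioo (-δ) δ) :
    T |y| = T y := by
  rcases abs_choice y with e | e <;> rw [e]
  exact h.T_neg y hy

theorem T_eq_T_iff (h : TrunkAndProngs F l s X T U μ₀ ε δ) {y y' : ℝ} (hy : y ∈ Set.Ioo (-δ) δ)
    (hy' : y' ∈ Set.Ioo (-δ) δ) : T y = T y' ↔ |y| = |y'| := by
  rw [← h.T_abs hy, ← h.T_abs hy']
  exact h.strictMonoOn_T.injOn.eq_iff ⟨abs_nonneg y, abs_lt.2 hy⟩ ⟨abs_nonneg y', abs_lt.2 hy'⟩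

theorem le_T (h : TrunkAndProngs F l s X T U μ₀ ε δ) {y : ℝ} (hy : y ∈ Set.Ioo (-δ) δ) :
    μ₀ ≤ T y := by
  have hyδ : |y| < δ := abs_lt.2 hy
  rw [← h.T_zero, ← h.T_abs hy]
  exact h.strictMonoOn_T.monotoneOn ⟨le_rfl, (abs_nonneg y).trans_lt hyδ⟩ ⟨abs_nonneg y, hyδ⟩
    (abs_nonneg y)

theorem zeros_eq_trunk (h : TrunkAndProngs F l s X T U μ₀ ε δ) {μ : ℝ}
    (hμ : μ ∈ Set.Ioc (μ₀ - ε) μ₀) : {x ∈ U | F μ x = 0} = {s μ} := by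
  have hμ' : μ ∈ Set.Ioo (μ₀ - ε) (μ₀ + ε) := ⟨hμ.1, by linarith [hμ.1, hμ.2]⟩
  refine Set.Subset.antisymm (fun x ⟨hxU, hx⟩ => ?_) (Set.singleton_subset_iff.2
    ⟨h.s_mem μ hμ', (h.zero_iff μ hμ' _ (h.s_mem μ hμ')).2 (Or.inl rfl)⟩)
  obtain rfl | ⟨y, hy, rfl, rfl⟩ := (h.zero_iff μ hμ' x hxU).1 hx
  · rfl
  · have T_eq : T y = μ₀ := le_antisymm hμ.2 (h.le_T hy)
    have zero_mem : (0 : ℝ) ∈ Set.Ioo (-δ) δ := by constructor <;> linarith [hy.1, hy.2]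
    rw [← h.T_zero, h.T_eq_T_iff hy zero_mem, abs_zero, abs_eq_zero] at T_eq
    rw [T_eq, h.X_zero, h.T_zero, Set.mem_singleton_iff]

theorem exists_zeros_eq_triple (h : TrunkAndProngs F l s X T U μ₀ ε δ) {μ : ℝ}
    (hμ : μ ∈ Set.Ioo μ₀ (μ₀ + ε)) :
    ∃ y ∈ Set.Ioo 0 δ, {x ∈ U | F μ x = 0} = {s μ, X y, X (-y)} := by
  obtain ⟨y, hy, rfl, hXy, hXny⟩ := h.exists_prongs μ hμ
  have hμ' : T y ∈ Set.Ioo (μ₀ - ε) (μ₀ + ε) := ⟨by linarith [hμ.1, hμ.2], hμ.2⟩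
  have hy' : y ∈ Set.Ioo (-δ) δ := ⟨by linarith [hy.1, hy.2], hy.2⟩
  have hny' : -y ∈ Set.Ioo (-δ) δ := ⟨by linarith [hy.2], by linarith [hy.1, hy.2]⟩
  refine ⟨y, hy, Set.Subset.antisymm (fun x ⟨hxU, hx⟩ => ?_) ?_⟩
  · obtain rfl | ⟨y', hy'δ, rfl, hT⟩ := (h.zero_iff _ hμ' x hxU).1 hx
    · exact Or.inl rfl
    · rcases abs_eq_abs.1 ((h.T_eq_T_iff hy' hy'δ).1 hT).symm with rfl | rfl <;> simp
  · rintro x (rfl | rfl | rfl)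
    · exact ⟨h.s_mem _ hμ', (h.zero_iff _ hμ' _ (h.s_mem _ hμ')).2 (Or.inl rfl)⟩
    · exact ⟨hXy, (h.zero_iff _ hμ' _ hXy).2 (Or.inr ⟨y, hy', rfl, rfl⟩)⟩
    · exact ⟨hXny, (h.zero_iff _ hμ' _ hXny).2 (Or.inr ⟨-y, hny', rfl, (h.T_neg y hy').symm⟩)⟩

theorem ncard_zeros_eq_three (h : TrunkAndProngs F l s X T U μ₀ ε δ) {μ : ℝ}
    (hμ : μ ∈ Set.Ioo μ₀ (μ₀ + ε)) : {x ∈ U | F μ x = 0}.ncard = 3 := by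
  obtain ⟨y, hy, zeros_eq⟩ := h.exists_zeros_eq_triple hμ
  have l_s : l (s μ) = 0 := h.l_s μ ⟨by linarith [hμ.1, hμ.2], hμ.2⟩
  have l_X : l (X y) = y := h.l_X y ⟨by linarith [hy.1, hy.2], hy.2⟩
  have l_X_neg : l (X (-y)) = -y := h.l_X _ ⟨by linarith [hy.2], by linarith [hy.1, hy.2]⟩
  rw [zeros_eq, Set.ncard_eq_three]
  refine ⟨_, _, _, fun e => ?_, fun e => ?_, fun e => ?_, rfl⟩ <;>
    linarith [hy.1, congrArg l e]

end TrunkAndProngs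

section Pitchfork

variable {E G : Type*} [NormedAddCommGroup E] [NormedSpace ℝ E] [Zero G] {F : ℝ → E → G} {μ₀ : ℝ}
  {x₀ : E} (l : E →L[ℝ] ℝ) {s X : ℝ → E} {T : ℝ → ℝ}

theorem exists_trunkAndProngs {δ : ℝ} (hδ : 0 < δ) (hs : ContinuousAt s μ₀) (hs₀ : s μ₀ = x₀)
    (hX : ContinuousAt X 0) (hX₀ : X 0 = x₀) (hT : ContinuousOn T (Set.Ioo (-δ) δ))
    (hT₀ : T 0 = μ₀) (T_neg : ∀ y ∈ Set.Ioo (-δ) δ, T (-y) = T y)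
    (strictMono : StrictMonoOn T (Set.Ico 0 δ)) (hls : ∀ᶠ μ in 𝓝 μ₀, l (s μ) = 0)
    (l_X : ∀ y ∈ Set.Ioo (-δ) δ, l (X y) = y)
    (hF : ∀ᶠ p : ℝ × E in 𝓝 (μ₀, x₀),
      F p.1 p.2 = 0 ↔ p.2 = s p.1 ∨ (p.2 = X (l p.2) ∧ p.1 = T (l p.2))) :
    ∃ U : Set E, IsOpen U ∧ x₀ ∈ U ∧ ∀ᶠ ε in 𝓝[>] 0, TrunkAndProngs F l s X T U μ₀ ε δ := by
  have hlx₀ : l x₀ = 0 := by rw [← hX₀, l_X 0 ⟨neg_lt_zero.2 hδ, hδ⟩]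
  rw [nhds_prod_eq] at hF
  obtain ⟨p, hp, q, hq, hpq⟩ := Filter.eventually_prod_iff.1 hF
  obtain ⟨V, hVq, hV, hx₀V⟩ := eventually_nhds_iff.1 hq
  have hU : IsOpen (V ∩ l ⁻¹' Set.Ioo (-δ) δ) := hV.inter (isOpen_Ioo.preimage l.continuous)
  have hx₀ : x₀ ∈ V ∩ l ⁻¹' Set.Ioo (-δ) δ := ⟨hx₀V, by simpa [hlx₀] using hδ⟩
  refine ⟨_, hU, hx₀, ?_⟩
  obtain ⟨η, hη, hXη⟩ := Metric.eventually_nhds_iff.1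
    (hX.eventually_mem (hX₀.symm ▸ hU.mem_nhds hx₀))
  simp only [Real.dist_eq, sub_zero] at hXη
  obtain ⟨ε, hε, hsε⟩ := Metric.eventually_nhds_iff.1
    ((hs.eventually_mem (hs₀.symm ▸ hU.mem_nhds hx₀)).and (hls.and hp))
  have hb : 0 < min η δ / 2 := by positivity
  have hbη : min η δ / 2 < η := by linarith [min_le_left η δ]
  have hbδ : min η δ / 2 < δ := by linarith [min_le_right η δ]
  have gap : 0 < T (min η δ / 2) - μ₀ := by
    rw [← hT₀]
    exact sub_pos.2 (strictMono ⟨le_rfl, hδ⟩ ⟨hb.le, hbδ⟩ hb)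
  filter_upwards [Ioo_mem_nhdsGT (lt_min hε gap)] with ε' hε'
  have near : ∀ μ ∈ Set.Ioo (μ₀ - ε') (μ₀ + ε'), dist μ μ₀ < ε := fun μ hμ =>
    (abs_sub_lt_iff.2 ⟨by linarith [hμ.2], by linarith [hμ.1]⟩ : |μ - μ₀| < ε').trans
      (hε'.2.trans_le (min_le_left _ _))
  refine ⟨fun μ hμ => (hsε (near μ hμ)).1, fun μ hμ => (hsε (near μ hμ)).2.1, l_X,
    hX₀.trans hs₀.symm, hT₀, T_neg, strictMono, fun μ hμ => ?_, fun μ hμ x hx => ?_⟩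
  · have hμb : μ ∈ Set.Ioo (T 0) (T (min η δ / 2)) :=
      ⟨by rw [hT₀]; exact hμ.1, by linarith [hμ.2, hε'.2, min_le_right ε (T (min η δ / 2) - μ₀)]⟩
    obtain ⟨y, hy, rfl⟩ := intermediate_value_Ioo hb.le
      (hT.mono (Set.Icc_subset_Ioo (neg_lt_zero.2 hδ) hbδ)) hμb
    have hyη : |y| < η := by rw [abs_of_pos hy.1]; exact hy.2.trans hbη
    exact ⟨y, ⟨hy.1, hy.2.trans hbδ⟩, rfl, hXη hyη, hXη (by rwa [abs_neg])⟩
  · rw [hpq (hsε (near μ hμ)).2.2 (hVq x hx.1)]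
    refine or_congr_right ⟨fun h => ⟨l x, hx.2, h.1, h.2⟩, ?_⟩
    rintro ⟨y, hy, rfl, h⟩
    rw [l_X y hy]
    exact ⟨rfl, h⟩

theorem deriv_ne_zero_of_leftInverse (hX : DifferentiableAt ℝ X 0)
    (hlX : ∀ᶠ y in 𝓝 (0 : ℝ), l (X y) = y) : deriv X 0 ≠ 0 := fun hX' => by
  have h : HasDerivAt (fun y => l (X y)) (l (deriv X 0)) 0 :=
    l.hasFDerivAt.comp_hasDerivAt 0 hX.hasDerivAt
  have := h.unique ((hasDerivAt_id (0 : ℝ)).congr_of_eventuallyEq hlX)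
  simp [hX'] at this

theorem isSupercriticalPitchfork_of_branches (hs : ∀ᶠ μ in 𝓝 μ₀, ContDiffAt ℝ ∞ s μ)
    (hs₀ : s μ₀ = x₀) (hX : ∀ᶠ y in 𝓝 0, ContDiffAt ℝ ∞ X y) (hX₀ : X 0 = x₀)
    (hT : ∀ᶠ y in 𝓝 0, ContDiffAt ℝ ∞ T y) (hT₀ : T 0 = μ₀)
    (hTeven : ∀ᶠ y in 𝓝 0, T (-y) = T y) (hT'' : 0 < deriv (deriv T) 0)
    (hls : ∀ᶠ μ in 𝓝 μ₀, l (s μ) = 0) (hlX : ∀ᶠ y in 𝓝 (0 : ℝ), l (X y) = y)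
    (hF : ∀ᶠ p : ℝ × E in 𝓝 (μ₀, x₀),
      F p.1 p.2 = 0 ↔ p.2 = s p.1 ∨ (p.2 = X (l p.2) ∧ p.1 = T (l p.2))) :
    IsSupercriticalPitchfork F μ₀ x₀ := by
  have hT' := deriv_zero_of_eventually_even hTeven
  obtain ⟨δ₁, hδ₁, hmono⟩ := exists_strictMonoOn_Ico_of_deriv_deriv_pos
    (hT.mono fun y hy => hy.continuousAt) hT' hT''
  obtain ⟨δ₂, hδ₂, near0⟩ := Metric.eventually_nhds_iff.1 (hX.and (hT.and (hTeven.and hlX)))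
  obtain ⟨ε₁, hε₁, hsε⟩ := Metric.eventually_nhds_iff.1 hs
  have hδ : 0 < min δ₁ δ₂ := lt_min hδ₁ hδ₂
  have hdist : ∀ y ∈ Set.Ioo (-min δ₁ δ₂) (min δ₁ δ₂), dist y 0 < δ₂ := fun y hy => by
    rw [Real.dist_eq, sub_zero]
    exact (abs_lt.2 hy).trans_le (min_le_right _ _)
  have hTδ : ContDiffOn ℝ ∞ T (Set.Ioo (-min δ₁ δ₂) (min δ₁ δ₂)) := fun y hy =>
    (near0 (hdist y hy)).2.1.contDiffWithinAt
  obtain ⟨U, hU, hx₀, hfork⟩ := exists_trunkAndProngs l hδ hs.self_of_nhds.continuousAt hs₀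
    hX.self_of_nhds.continuousAt hX₀ hTδ.continuousOn hT₀
    (fun y hy => (near0 (hdist y hy)).2.2.1)
    (hmono.mono (Set.Ico_subset_Ico_right (min_le_left _ _))) hls
    (fun y hy => (near0 (hdist y hy)).2.2.2) hF
  obtain ⟨ε, fork, hε, hεε₁⟩ := (hfork.and (Ioo_mem_nhdsGT hε₁)).exists
  refine ⟨U, ε, min δ₁ δ₂, s, X, T, hU, hx₀, hε, hδ, fun μ hμ => ?_, hs₀,
    fun y hy => (near0 (hdist y hy)).1.contDiffWithinAt, hX₀,
    deriv_ne_zero_of_leftInverse l (hX.self_of_nhds.differentiableAt (by simp)) hlX,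
    hTδ, hT₀, hT', hT'', fork.zero_iff, fun μ hμ => ?_, fun μ hμ => fork.ncard_zeros_eq_three hμ⟩
  · refine (hsε ?_).contDiffWithinAt
    exact (abs_sub_lt_iff.2 ⟨by linarith [hμ.2], by linarith [hμ.1]⟩ : |μ - μ₀| < ε).trans hεε₁
  · rw [fork.zeros_eq_trunk hμ, Set.ncard_singleton]

end Pitchfork

/-! ### Functions with a prescribed even and odd part -/

section EvenOdd

variable {E : Type*} [NormedAddCommGroup E] [NormedSpace ℝ E] {g k : ℝ → E}

theorem hasDerivAt_comp_sq_add_smul_comp_sq {y : ℝ} (hg : DifferentiableAt ℝ g (y ^ 2))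
    (hk : DifferentiableAt ℝ k (y ^ 2)) :
    HasDerivAt (fun y => g (y ^ 2) + y • k (y ^ 2))
      ((k (y ^ 2) + (2 * y ^ 2) • deriv k (y ^ 2)) + y • (2 : ℝ) • deriv g (y ^ 2)) y := by
  have sq : HasDerivAt (fun y : ℝ => y ^ 2) (2 * y) y := by simpa using hasDerivAt_pow 2 y
  refine ((hg.hasDerivAt.scomp (h := fun y => y ^ 2) y sq).add
    ((hasDerivAt_id y).smul (hk.hasDerivAt.scomp (h := fun y => y ^ 2) y sq))).congr_deriv ?_
  simp only [Function.comp_apply, id]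
  module

theorem hasDerivAt_comp_sq_add_smul_comp_sq_zero (hg : DifferentiableAt ℝ g 0)
    (hk : DifferentiableAt ℝ k 0) : HasDerivAt (fun y => g (y ^ 2) + y • k (y ^ 2)) (k 0) 0 := by
  have sq_zero : (0 : ℝ) ^ 2 = 0 := zero_pow two_ne_zero
  refine (hasDerivAt_comp_sq_add_smul_comp_sq (y := 0) (by rwa [sq_zero])
    (by rwa [sq_zero])).congr_deriv ?_
  simp

variable [CompleteSpace E]

theorem deriv_comp_sq_add_smul_comp_sq_eventuallyEq (hg : AnalyticAt ℝ g 0)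
    (hk : AnalyticAt ℝ k 0) :
    deriv (fun y => g (y ^ 2) + y • k (y ^ 2)) =ᶠ[𝓝 0]
      fun y => (k (y ^ 2) + (2 * y ^ 2) • deriv k (y ^ 2)) + y • (2 : ℝ) • deriv g (y ^ 2) := by
  have sq : Filter.Tendsto (fun y : ℝ => y ^ 2) (𝓝 0) (𝓝 0) :=
    (continuous_pow 2).tendsto' 0 0 (zero_pow two_ne_zero)
  filter_upwards [sq.eventually hg.eventually_analyticAt, sq.eventually hk.eventually_analyticAt]
    with y hgy hky
  exact (hasDerivAt_comp_sq_add_smul_comp_sq hgy.differentiableAt hky.differentiableAt).deriv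

theorem deriv_deriv_comp_sq_add_smul_comp_sq (hg : AnalyticAt ℝ g 0) (hk : AnalyticAt ℝ k 0) :
    deriv (deriv fun y => g (y ^ 2) + y • k (y ^ 2)) 0 = (2 : ℝ) • deriv g 0 := by
  rw [(deriv_comp_sq_add_smul_comp_sq_eventuallyEq hg hk).deriv_eq]
  exact (hasDerivAt_comp_sq_add_smul_comp_sq_zero (g := fun s => k s + (2 * s) • deriv k s)
    (k := fun s => (2 : ℝ) • deriv g s)
    (hk.add ((analyticAt_const.mul analyticAt_id).smul hk.deriv)).differentiableAt
    (hg.deriv.const_smul).differentiableAt).deriv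

theorem deriv_deriv_deriv_comp_sq_add_smul_comp_sq (hg : AnalyticAt ℝ g 0)
    (hk : AnalyticAt ℝ k 0) :
    deriv (deriv (deriv fun y => g (y ^ 2) + y • k (y ^ 2))) 0 = (6 : ℝ) • deriv k 0 := by
  have deriv_even : HasDerivAt (fun s => k s + (2 * s) • deriv k s)
      (deriv k 0 + ((2 * (0 : ℝ)) • deriv (deriv k) 0 + (2 * (1 : ℝ)) • deriv k 0)) 0 :=
    hk.differentiableAt.hasDerivAt.add (((hasDerivAt_id 0).const_mul 2).smul
      hk.deriv.differentiableAt.hasDerivAt)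
  rw [(deriv_comp_sq_add_smul_comp_sq_eventuallyEq hg hk).deriv.deriv_eq,
    deriv_deriv_comp_sq_add_smul_comp_sq (g := fun s => k s + (2 * s) • deriv k s)
      (k := fun s => (2 : ℝ) • deriv g s)
      (hk.add ((analyticAt_const.mul analyticAt_id).smul hk.deriv)) hg.deriv.const_smul,
    deriv_even.deriv]
  module

end EvenOdd

namespace Dziobek

open PolyExpr

/-! ### The Dziobek equations as polynomial expressions -/

/-- The square of the `i`-th unknown. -/
def sqExpr (i : Fin 9) : PolyExpr (Fin 9) := var i * var i

/-- The Cayley–Menger determinant. -/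
def cayleyMengerExpr : PolyExpr (Fin 9) :=
  let A := sqExpr 2
  let P := sqExpr 3
  let S := sqExpr 4
  let Q := sqExpr 5
  let T := sqExpr 6
  let D := sqExpr 7
  const 2 * (A * D * (P + Q + S + T - A - D) + P * T * (A + D + S + Q - P - T)
    + S * Q * (A + D + P + T - S - Q) - (A * P * Q + A * S * T + D * P * S + D * Q * T))

/-- The total mass; the last variable is the mass `m`. -/
def totalMassExpr : PolyExpr (Fin 9) := const 2 + const 2 * var 8

/-- The product of the masses of the `k`-th pair. -/
def massProdExpr : Fin 6 → PolyExpr (Fin 9) :=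
  ![const 1, var 8, var 8, var 8, var 8, var 8 * var 8]

/-- The equation belonging to the `k`-th mutual distance. -/
def distExpr (k : Fin 6) : PolyExpr (Fin 9) :=
  let r : PolyExpr (Fin 9) := var k.succ.succ.castSucc
  massProdExpr k * (const 2 * var 0 * (r * r * r) - totalMassExpr)
    + totalMassExpr * var 1 * (r * r) * pderiv k.succ.succ.castSucc cayleyMengerExpr

/-- The components of `F`, as polynomials in the eight unknowns and the mass. -/
def systemExpr : Fin 8 → PolyExpr (Fin 9) :=
  ![sqExpr 2 + var 8 * (sqExpr 3 + sqExpr 4 + sqExpr 5 + sqExpr 6) + var 8 * var 8 * sqExpr 7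
      - totalMassExpr,
    cayleyMengerExpr, distExpr 0, distExpr 1, distExpr 2, distExpr 3, distExpr 4, distExpr 5]

/-- Eight unknowns preceded by a parameter, as the values of nine variables of which the parameter
is the last one. -/
noncomputable def extend : ℝ × Vars →L[ℝ] Fin 9 → ℝ :=
  LinearMap.toContinuousLinearMap
    { toFun := fun p => ![p.2 0, p.2 1, p.2 2, p.2 3, p.2 4, p.2 5, p.2 6, p.2 7, p.1]
      map_add' := fun p q => by funext i; fin_cases i <;> simp
      map_smul' := fun c p => by funext i; fin_cases i <;> simp }

theorem extend_apply (s : ℝ) (x : Vars) :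
    extend (s, x) = ![x 0, x 1, x 2, x 3, x 4, x 5, x 6, x 7, s] := rfl

@[simp] theorem extend_castSucc (p : ℝ × Vars) (i : Fin 8) : extend p i.castSucc = p.2 i := by
  fin_cases i <;> rfl

@[simp] theorem extend_last (p : ℝ × Vars) : extend p 8 = p.1 := rfl

theorem extend_update (s : ℝ) (x : Vars) (i : Fin 8) (t : ℝ) :
    extend (s, Function.update x i t) = Function.update (extend (s, x)) i.castSucc t := by
  funext j
  fin_cases i <;> fin_cases j <;> simp [extend_apply]

theorem extend_eq_update (s t : ℝ) (x : Vars) :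
    extend (t, x) = Function.update (extend (s, x)) 8 t := by
  funext j
  fin_cases j <;> simp [extend_apply]

theorem cayleyMenger_eq_eval (m : ℝ) (x : Vars) :
    cayleyMenger x = cayleyMengerExpr.eval (extend (m, x)) := by
  simp [cayleyMenger, cayleyMengerExpr, sqExpr, extend_apply, Matrix.det_succ_row_zero,
    Fin.sum_univ_succ, Fin.succAbove]
  ring

theorem partialDeriv_cayleyMenger (m : ℝ) (x : Vars) (i : Fin 8) :
    partialDeriv cayleyMenger i x = (pderiv i.castSucc cayleyMengerExpr).eval (extend (m, x)) := by
  have h := cayleyMengerExpr.hasDerivAt_eval_update (extend (m, x)) i.castSucc (x i)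
  simp only [← extend_update, ← cayleyMenger_eq_eval, Function.update_eq_self] at h
  exact h.deriv

theorem totalMass_eq_eval (m : ℝ) (x : Vars) :
    totalMass ![1, 1, m, m] = totalMassExpr.eval (extend (m, x)) := by
  simp only [totalMass, Fin.sum_univ_four, Matrix.cons_val, totalMassExpr, eval_add, eval_mul,
    eval_const, eval_var, extend_last]
  push_cast
  ring

theorem massProd_eq_eval (m : ℝ) (x : Vars) (k : Fin 6) :
    massProd ![1, 1, m, m] k = (massProdExpr k).eval (extend (m, x)) := by
  fin_cases k <;> simp [massProd, massProdExpr, fstIdx, sndIdx]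

theorem F_apply_succ_succ (m : ℝ) (x : Vars) (k : Fin 6) :
    F m x k.succ.succ = (distExpr k).eval (extend (m, x)) := by
  have h0 : extend (m, x) 0 = x 0 := rfl
  have h1 : extend (m, x) 1 = x 1 := rfl
  simp only [F, system, Matrix.cons_val_succ, distExpr, totalMass_eq_eval m x,
    massProd_eq_eval m x, partialDeriv_cayleyMenger m x, mutualDist, eval_add, eval_mul, eval_sub,
    eval_const, eval_var, extend_castSucc, h0, h1]
  push_cast
  ring

theorem F_apply (m : ℝ) (x : Vars) (i : Fin 8) :
    F m x i = (systemExpr i).eval (extend (m, x)) := by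
  refine Fin.cases ?_ (fun i => Fin.cases ?_ (fun k => ?_) i) i
  · simp only [F, system, totalMass_eq_eval m x, massProd_eq_eval m x, systemExpr, massProdExpr,
      mutualDist, sqExpr, extend_apply, Fin.sum_univ_six, Fin.succ_zero_eq_one, Fin.succ_one_eq_two,
      Fin.reduceSucc, Matrix.cons_val, eval_add, eval_sub, eval_mul, eval_const, eval_var]
    push_cast
    ring
  · exact cayleyMenger_eq_eval m x
  · rw [F_apply_succ_succ]
    fin_cases k <;> rfl

theorem F_swap12 (m : ℝ) (x : Vars) : F m (swap12 x) = swap12 (F m x) := by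
  funext i
  fin_cases i <;>
    simp [swap12, F_apply, systemExpr, distExpr, massProdExpr, cayleyMengerExpr, sqExpr,
      totalMassExpr, extend_apply, -mul_eq_mul_left_iff, -mul_eq_mul_right_iff] <;> ring

theorem contDiff_F {n : WithTop ℕ∞} : ContDiff ℝ n fun p : ℝ × Vars => F p.1 p.2 := by
  refine contDiff_pi.2 fun i => ?_
  simp only [F_apply]
  exact (systemExpr i).contDiff_eval.comp extend.contDiff

theorem contDiff_F_right {n : WithTop ℕ∞} (m : ℝ) : ContDiff ℝ n (F m) :=
  ContDiff.comp (g := fun p : ℝ × Vars => F p.1 p.2) (f := fun x : Vars => (m, x)) contDiff_F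
    (contDiff_const.prodMk contDiff_id)

theorem hasFDerivAt_F (m : ℝ) (x : Vars) : HasFDerivAt (F m) (fderiv ℝ (F m) x) x :=
  ((contDiff_F_right (n := 1) m).differentiable one_ne_zero x).hasFDerivAt

theorem jacobian_mulVec (m : ℝ) (x u : Vars) :
    (jacobian m x).mulVec u = fderiv ℝ (F m) x u :=
  LinearMap.toMatrix'_mulVec _ _

/-! ### Symmetric and antisymmetric vectors -/

/-- The vector that is invariant under the exchange of the bodies 1 and 2 and has the components
`λ₀, μ, r₁₂, r₁₃, r₁₄, r₃₄` given by `p`. -/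
noncomputable def symVec : (Fin 6 → ℝ) →L[ℝ] Vars :=
  LinearMap.toContinuousLinearMap
    { toFun := fun p => ![p 0, p 1, p 2, p 3, p 4, p 3, p 4, p 5]
      map_add' := fun p q => by funext i; fin_cases i <;> simp
      map_smul' := fun c p => by funext i; fin_cases i <;> simp }

theorem symVec_apply (p : Fin 6 → ℝ) :
    symVec p = ![p 0, p 1, p 2, p 3, p 4, p 3, p 4, p 5] := rfl

/-- The vector whose sign is changed by the exchange of the bodies 1 and 2 and which has the
components `q.1` and `q.2` at `r₁₃` and `r₂₄`. -/
noncomputable def antiVec : ℝ × ℝ →L[ℝ] Vars :=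
  LinearMap.toContinuousLinearMap
    { toFun := fun q => ![0, 0, 0, q.1, -q.2, -q.1, q.2, 0]
      map_add' := fun p q => by funext i; fin_cases i <;> simp <;> ring
      map_smul' := fun c p => by funext i; fin_cases i <;> simp }

theorem antiVec_apply (q : ℝ × ℝ) : antiVec q = ![0, 0, 0, q.1, -q.2, -q.1, q.2, 0] := rfl

/-- The coordinates of the symmetric part of a vector; see `symVec`. -/
noncomputable def symPart : Vars →L[ℝ] Fin 6 → ℝ :=
  LinearMap.toContinuousLinearMap
    { toFun := fun x => ![x 0, x 1, x 2, (x 3 + x 5) / 2, (x 4 + x 6) / 2, x 7]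
      map_add' := fun x x' => by funext i; fin_cases i <;> simp <;> ring
      map_smul' := fun c x => by funext i; fin_cases i <;> simp <;> ring }

theorem symPart_apply (x : Vars) :
    symPart x = ![x 0, x 1, x 2, (x 3 + x 5) / 2, (x 4 + x 6) / 2, x 7] := rfl

/-- The coordinates of the antisymmetric part of a vector; see `antiVec`. -/
noncomputable def antiPart : Vars →L[ℝ] ℝ × ℝ :=
  LinearMap.toContinuousLinearMap
    { toFun := fun x => ((x 3 - x 5) / 2, (x 6 - x 4) / 2)
      map_add' := fun x x' => by ext <;> simp <;> ring
      map_smul' := fun c x => by ext <;> simp <;> ring }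

theorem antiPart_apply (x : Vars) : antiPart x = ((x 3 - x 5) / 2, (x 6 - x 4) / 2) := rfl

@[simp] theorem symPart_symVec (p : Fin 6 → ℝ) : symPart (symVec p) = p := by
  funext i
  fin_cases i <;> simp [symPart_apply, symVec_apply]

@[simp] theorem symPart_antiVec (q : ℝ × ℝ) : symPart (antiVec q) = 0 := by
  funext i
  fin_cases i <;> simp [symPart_apply, antiVec_apply]

@[simp] theorem antiPart_symVec (p : Fin 6 → ℝ) : antiPart (symVec p) = 0 := by
  ext <;> simp [antiPart_apply, symVec_apply]

@[simp] theorem antiPart_antiVec (q : ℝ × ℝ) : antiPart (antiVec q) = q := by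
  ext <;> simp [antiPart_apply, antiVec_apply]

theorem symVec_symPart_add_antiVec_antiPart (x : Vars) :
    symVec (symPart x) + antiVec (antiPart x) = x := by
  funext i
  fin_cases i <;> simp [symPart_apply, symVec_apply, antiPart_apply, antiVec_apply] <;> ring

theorem symVec_symPart {x : Vars} (h3 : x 3 = x 5) (h4 : x 4 = x 6) : symVec (symPart x) = x := by
  have antiPart_eq_zero : antiPart x = 0 := by simp [antiPart_apply, h3, h4]
  simpa [antiPart_eq_zero] using symVec_symPart_add_antiVec_antiPart x

theorem swap12_symVec_add_antiVec (p : Fin 6 → ℝ) (q : ℝ × ℝ) :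
    swap12 (symVec p + antiVec q) = symVec p - antiVec q := by
  funext i
  fin_cases i <;> simp [swap12, symVec_apply, antiVec_apply, sub_eq_add_neg]

theorem swap12_antiVec (q : ℝ × ℝ) : swap12 (antiVec q) = -antiVec q := by
  simpa using swap12_symVec_add_antiVec 0 q

theorem antiVec_dotProduct (q : ℝ × ℝ) (x : Vars) :
    antiVec q ⬝ᵥ x = 2 * (q.1 * (antiPart x).1 + q.2 * (antiPart x).2) := by
  simp only [antiVec_apply, antiPart_apply, dotProduct, Fin.sum_univ_eight, Matrix.cons_val]
  ring

/-! ### The blown-up equations -/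

/-- The unknowns in terms of the symmetric part `(λ₀, μ, r₁₂, r₁₃, r₁₄, r₃₄)`, the slope `α` and the
mass (variables `0` to `7`): a symmetric configuration is displaced by `y` in the direction
`(0, 0, 0, α, -1, -α, 1, 0)`. -/
def displacedExpr : Fin 9 → PolyExpr (Fin 9) × PolyExpr (Fin 9) :=
  ![(var 0, const 0), (var 1, const 0), (var 2, const 0), (var 3, var 6), (var 4, const (-1)),
    (var 3, -var 6), (var 4, const 1), (var 5, const 0), (var 7, const 0)]

/-- The even part of the displaced `i`-th equation; variable `8` is `y²`. -/
def evenExpr (i : Fin 8) : PolyExpr (Fin 9) := (split displacedExpr (var 8) (systemExpr i)).1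

/-- The odd part of the displaced `i`-th equation, divided by `y`. -/
def oddExpr (i : Fin 8) : PolyExpr (Fin 9) := (split displacedExpr (var 8) (systemExpr i)).2

/-- The even parts of the equations for `λ₀, μ, r₁₂, r₁₃, r₂₄, r₃₄` and the odd parts, divided by
`y`, of those for `r₁₃` and `r₂₄`. -/
def blowUpExpr : Fin 8 → PolyExpr (Fin 9) :=
  ![evenExpr 0, evenExpr 1, evenExpr 2, evenExpr 3, evenExpr 6, evenExpr 7, oddExpr 3, oddExpr 6]

/-- The blown-up equations in `u = (λ₀, μ, r₁₂, r₁₃, r₁₄, r₃₄, α, m)`, where `p = (y², u)`. -/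
noncomputable def blowUp (p : ℝ × Vars) : Vars := fun i => (blowUpExpr i).eval (extend p)

/-- The first six of eight coordinates. -/
noncomputable def evenCoords : Vars →L[ℝ] Fin 6 → ℝ :=
  ContinuousLinearMap.pi fun i => ContinuousLinearMap.proj (Fin.castAdd 2 i)

/-- The symmetric vector formed from the first six coordinates. -/
noncomputable def evenVec : Vars →L[ℝ] Vars := symVec ∘L evenCoords

/-- The antisymmetric vector formed from the last two coordinates. -/
noncomputable def oddVec : Vars →L[ℝ] Vars :=
  antiVec ∘L (ContinuousLinearMap.proj 6).prod (ContinuousLinearMap.proj 7)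

theorem evenCoords_apply (u : Vars) (i : Fin 6) : evenCoords u i = u (Fin.castAdd 2 i) := rfl

theorem evenVec_apply (u : Vars) : evenVec u = symVec (evenCoords u) := rfl

theorem oddVec_apply (u : Vars) : oddVec u = antiVec (u 6, u 7) := rfl

/-- The symmetric configuration in `u`, displaced by `y` in the antisymmetric direction whose slope
is the coordinate `u 6`. -/
noncomputable def displaced (u : Vars) (y : ℝ) : Vars := evenVec u + y • antiVec (u 6, 1)

theorem swap12_displaced (u : Vars) (y : ℝ) : swap12 (displaced u y) = displaced u (-y) := by
  rw [displaced, evenVec_apply, ← map_smul, swap12_symVec_add_antiVec, displaced, evenVec_apply,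
    neg_smul, map_smul, sub_eq_add_neg]

theorem F_displaced_apply (u : Vars) (y : ℝ) (i : Fin 8) :
    F (u 7) (displaced u y) i
      = (evenExpr i).eval (extend (y ^ 2, u)) + y * (oddExpr i).eval (extend (y ^ 2, u)) := by
  rw [F_apply, evenExpr, oddExpr, ← eval_split displacedExpr (var 8) (extend (y ^ 2, u)) y rfl]
  congr 1
  funext j
  fin_cases j <;> simp [extend_apply, displaced, displacedExpr, symVec_apply, antiVec_apply,
    evenVec_apply, evenCoords_apply]

theorem F_displaced (u : Vars) (y : ℝ) :
    F (u 7) (displaced u y)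
      = evenVec (blowUp (y ^ 2, u)) + y • oddVec (blowUp (y ^ 2, u)) := by
  have swapped : F (u 7) (displaced u y) = swap12 (F (u 7) (displaced u (-y))) := by
    rw [← F_swap12, swap12_displaced, neg_neg]
  have at_y := F_displaced_apply u y
  have at_neg_y := F_displaced_apply u (-y)
  rw [neg_sq] at at_neg_y
  funext i
  have h := congrFun swapped i
  fin_cases i <;>
    simp [swap12, at_y, at_neg_y, evenVec_apply, symVec_apply, oddVec_apply,
      antiVec_apply, evenCoords_apply, blowUp, blowUpExpr, -mul_eq_zero] at h ⊢ <;> linarith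

/-! ### Derivatives at a symmetric configuration -/

theorem contDiff_blowUp {n : WithTop ℕ∞} : ContDiff ℝ n blowUp :=
  contDiff_pi.2 fun i => (blowUpExpr i).contDiff_eval.comp extend.contDiff

/-- The partial derivative of the blown-up equations in the `j`-th of the variables `u`, and in `y²`
if `j = 8`. -/
noncomputable def blowUpPartial (j : Fin 9) (p : ℝ × Vars) : Vars :=
  fun i => ((blowUpExpr i).pderiv j).eval (extend p)

theorem blowUpPartial_apply (j : Fin 9) (p : ℝ × Vars) (i : Fin 8) :
    blowUpPartial j p i = ((blowUpExpr i).pderiv j).eval (extend p) := rfl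

/-- The Jacobian matrix of the blown-up equations in the variables `u`. -/
noncomputable def blowUpJac (p : ℝ × Vars) : Matrix (Fin 8) (Fin 8) ℝ :=
  Matrix.of fun i j => blowUpPartial j.castSucc p i

/-- The block of the Jacobian matrix that belongs to the symmetric vectors. -/
noncomputable def symJac (p : ℝ × Vars) : Matrix (Fin 6) (Fin 6) ℝ :=
  (blowUpJac p).submatrix (Fin.castAdd 2) (Fin.castAdd 2)

/-- The total derivative of the blown-up equations. -/
noncomputable def blowUpDeriv (p : ℝ × Vars) : ℝ × Vars →L[ℝ] Vars :=
  ContinuousLinearMap.pi fun i => (blowUpExpr i).differential (extend p) ∘L extend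

theorem hasStrictFDerivAt_blowUp (p : ℝ × Vars) : HasStrictFDerivAt blowUp (blowUpDeriv p) p :=
  hasStrictFDerivAt_pi.2 fun i =>
    ((blowUpExpr i).hasStrictFDerivAt_eval (extend p)).comp p extend.hasStrictFDerivAt

theorem blowUpDeriv_apply (p q : ℝ × Vars) :
    blowUpDeriv p q = q.1 • blowUpPartial 8 p + (blowUpJac p).mulVec q.2 := by
  funext i
  simp only [blowUpDeriv, ContinuousLinearMap.pi_apply, ContinuousLinearMap.comp_apply,
    PolyExpr.differential_apply, Fin.sum_univ_castSucc (n := 8), extend_castSucc, Pi.add_apply,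
    Pi.smul_apply, smul_eq_mul, Matrix.mulVec, dotProduct, blowUpJac, Matrix.of_apply]
  rw [add_comm, mul_comm q.1]
  rfl

theorem col_blowUpJac (p : ℝ × Vars) (j : Fin 8) :
    (blowUpJac p).col j = blowUpPartial j.castSucc p := rfl

theorem hasDerivAt_blowUp_comp {c : ℝ → ℝ × Vars} {c' : ℝ × Vars} {t : ℝ}
    (hc : HasDerivAt c c' t) :
    HasDerivAt (fun t => blowUp (c t))
      (c'.1 • blowUpPartial 8 (c t) + (blowUpJac (c t)).mulVec c'.2) t := by
  rw [← blowUpDeriv_apply]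
  exact (hasStrictFDerivAt_blowUp (c t)).hasFDerivAt.comp_hasDerivAt t hc

theorem hasDerivAt_blowUp_update (s : ℝ) (u : Vars) (j : Fin 8) :
    HasDerivAt (fun t => blowUp (s, Function.update u j t)) (blowUpPartial j.castSucc (s, u))
      (u j) := by
  simpa [col_blowUpJac] using
    hasDerivAt_blowUp_comp ((hasDerivAt_const (u j) s).prodMk (hasDerivAt_update u j (u j)))

theorem hasDerivAt_blowUp_left (s : ℝ) (u : Vars) :
    HasDerivAt (fun s => blowUp (s, u)) (blowUpPartial 8 (s, u)) s := by
  simpa using hasDerivAt_blowUp_comp ((hasDerivAt_id s).prodMk (hasDerivAt_const s u))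

theorem analyticAt_clm_blowUp_left (L : Vars →L[ℝ] Vars) (u : Vars) :
    AnalyticAt ℝ (fun s => L (blowUp (s, u))) 0 :=
  (L.contDiff.comp (contDiff_blowUp.comp (contDiff_id.prodMk contDiff_const))).contDiffAt.analyticAt

theorem deriv_clm_blowUp_left (L : Vars →L[ℝ] Vars) (u : Vars) :
    deriv (fun s => L (blowUp (s, u))) 0 = L (blowUpPartial 8 (0, u)) :=
  (L.hasFDerivAt.comp_hasDerivAt 0 (hasDerivAt_blowUp_left 0 u)).deriv

theorem displaced_zero (u : Vars) : displaced u 0 = evenVec u := by simp [displaced]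

theorem F_evenVec (u : Vars) : F (u 7) (evenVec u) = evenVec (blowUp (0, u)) := by
  simpa [displaced_zero] using F_displaced u 0

theorem hasDerivAt_displaced (u : Vars) (y : ℝ) :
    HasDerivAt (displaced u) (antiVec (u 6, 1)) y := by
  refine (((hasDerivAt_id y).smul_const (antiVec (u 6, 1))).const_add (evenVec u)).congr_deriv ?_
  rw [one_smul]

theorem evenVec_update_six (u : Vars) (t : ℝ) : evenVec (Function.update u 6 t) = evenVec u := by
  funext i
  fin_cases i <;> simp [evenVec_apply, symVec_apply, evenCoords_apply]

theorem fderiv_F_antiVec_slope (u : Vars) :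
    fderiv ℝ (F (u 7)) (evenVec u) (antiVec (u 6, 1)) = oddVec (blowUp (0, u)) := by
  have along_displaced : HasDerivAt (fun y => F (u 7) (displaced u y))
      (fderiv ℝ (F (u 7)) (displaced u 0) (antiVec (u 6, 1))) 0 :=
    (hasFDerivAt_F _ _).comp_hasDerivAt 0 (hasDerivAt_displaced u 0)
  rw [displaced_zero] at along_displaced
  simp only [F_displaced] at along_displaced
  exact along_displaced.unique <| hasDerivAt_comp_sq_add_smul_comp_sq_zero
    (g := fun s => evenVec (blowUp (s, u))) (k := fun s => oddVec (blowUp (s, u)))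
    (analyticAt_clm_blowUp_left _ u).differentiableAt
    (analyticAt_clm_blowUp_left _ u).differentiableAt

theorem fderiv_F_antiVec_one_zero (u : Vars) :
    fderiv ℝ (F (u 7)) (evenVec u) (antiVec (1, 0)) = oddVec (blowUpPartial 6 (0, u)) := by
  have slope (t : ℝ) : fderiv ℝ (F (u 7)) (evenVec u) (antiVec (t, 1))
      = oddVec (blowUp (0, Function.update u 6 t)) := by
    have h := fderiv_F_antiVec_slope (Function.update u 6 t)
    rwa [evenVec_update_six, Function.update_self, Function.update_of_ne (by decide)] at h
  have along_slope : HasDerivAt (fun t => fderiv ℝ (F (u 7)) (evenVec u) (antiVec (t, 1)))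
      (fderiv ℝ (F (u 7)) (evenVec u) (antiVec (1, 0))) (u 6) :=
    (fderiv ℝ (F (u 7)) (evenVec u) ∘L antiVec).hasFDerivAt.comp_hasDerivAt (u 6)
      ((hasDerivAt_id (u 6)).prodMk (hasDerivAt_const (u 6) 1))
  simp only [slope] at along_slope
  exact along_slope.unique
    (oddVec.hasFDerivAt.comp_hasDerivAt (u 6) (hasDerivAt_blowUp_update 0 u 6))

theorem fderiv_F_antiVec (u : Vars) (a b : ℝ) :
    fderiv ℝ (F (u 7)) (evenVec u) (antiVec (a, b))
      = (a - b * u 6) • oddVec (blowUpPartial 6 (0, u)) + b • oddVec (blowUp (0, u)) := by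
  have decompose : ((a, b) : ℝ × ℝ) = (a - b * u 6) • (1, 0) + b • (u 6, 1) := by ext <;> simp
  rw [decompose, map_add, map_smul, map_smul, map_add, map_smul, map_smul,
    fderiv_F_antiVec_one_zero, fderiv_F_antiVec_slope]

theorem fderiv_F_evenVec (u : Vars) {v : Vars} (hv : v 7 = 0) :
    fderiv ℝ (F (u 7)) (evenVec u) (evenVec v) = evenVec ((blowUpJac (0, u)).mulVec v) := by
  have line : HasDerivAt (fun t : ℝ => u + t • v) v 0 := by
    simpa using ((hasDerivAt_id (0 : ℝ)).smul_const v).const_add u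
  have F_line (t : ℝ) : F (u 7) (evenVec (u + t • v)) = evenVec (blowUp (0, u + t • v)) := by
    simpa [hv] using F_evenVec (u + t • v)
  have along_line : HasDerivAt (fun t : ℝ => F (u 7) (evenVec (u + t • v)))
      (fderiv ℝ (F (u 7)) (evenVec (u + (0 : ℝ) • v)) (evenVec v)) 0 :=
    (hasFDerivAt_F _ _).comp_hasDerivAt 0 (evenVec.hasFDerivAt.comp_hasDerivAt 0 line)
  simp only [F_line] at along_line
  simpa using along_line.unique (evenVec.hasFDerivAt.comp_hasDerivAt 0
    (hasDerivAt_blowUp_comp ((hasDerivAt_const (0 : ℝ) (0 : ℝ)).prodMk line)))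

/-- The eight variables of the blown-up equations with even part `p`, slope `a` and mass `m`. -/
def coords (p : Fin 6 → ℝ) (a m : ℝ) : Vars := ![p 0, p 1, p 2, p 3, p 4, p 5, a, m]

@[simp] theorem evenCoords_coords (p : Fin 6 → ℝ) (a m : ℝ) : evenCoords (coords p a m) = p := by
  funext i
  fin_cases i <;> rfl

@[simp] theorem evenVec_coords (p : Fin 6 → ℝ) (a m : ℝ) : evenVec (coords p a m) = symVec p := by
  rw [evenVec_apply, evenCoords_coords]

theorem fderiv_F_symVec (u : Vars) (p : Fin 6 → ℝ) :
    fderiv ℝ (F (u 7)) (evenVec u) (symVec p) = symVec ((symJac (0, u)).mulVec p) := by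
  rw [← evenVec_coords p 0 0, fderiv_F_evenVec u rfl, evenVec_apply]
  congr 1
  funext i
  simp [evenCoords_apply, symJac, Matrix.mulVec, dotProduct, coords, Fin.sum_univ_succ]

theorem iteratedFDeriv_F_antiVec (u : Vars) (k : ℕ) :
    iteratedFDeriv ℝ k (F (u 7)) (evenVec u) (fun _ => antiVec (u 6, 1))
      = iteratedDeriv k
        (fun y => evenVec (blowUp (y ^ 2, u)) + y • oddVec (blowUp (y ^ 2, u))) 0 := by
  rw [iteratedFDeriv_apply_const (contDiff_F_right (u 7))]
  simp only [← F_displaced, displaced]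

theorem iteratedFDeriv_two_F_antiVec (u : Vars) :
    iteratedFDeriv ℝ 2 (F (u 7)) (evenVec u) ![antiVec (u 6, 1), antiVec (u 6, 1)]
      = (2 : ℝ) • evenVec (blowUpPartial 8 (0, u)) := by
  have const_eq : ![antiVec (u 6, 1), antiVec (u 6, 1)] = fun _ => antiVec (u 6, 1) := by
    funext i
    fin_cases i <;> rfl
  rw [const_eq, iteratedFDeriv_F_antiVec, ← deriv_clm_blowUp_left, iteratedDeriv_succ,
    iteratedDeriv_one]
  exact deriv_deriv_comp_sq_add_smul_comp_sq (analyticAt_clm_blowUp_left evenVec u)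
    (analyticAt_clm_blowUp_left oddVec u)

theorem iteratedFDeriv_three_F_antiVec (u : Vars) :
    iteratedFDeriv ℝ 3 (F (u 7)) (evenVec u)
        ![antiVec (u 6, 1), antiVec (u 6, 1), antiVec (u 6, 1)]
      = (6 : ℝ) • oddVec (blowUpPartial 8 (0, u)) := by
  have const_eq : ![antiVec (u 6, 1), antiVec (u 6, 1), antiVec (u 6, 1)]
      = fun _ => antiVec (u 6, 1) := by
    funext i
    fin_cases i <;> rfl
  rw [const_eq, iteratedFDeriv_F_antiVec, ← deriv_clm_blowUp_left, iteratedDeriv_succ,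
    iteratedDeriv_succ, iteratedDeriv_one]
  exact deriv_deriv_deriv_comp_sq_add_smul_comp_sq (analyticAt_clm_blowUp_left evenVec u)
    (analyticAt_clm_blowUp_left oddVec u)

theorem hasDerivAt_F_mass (m : ℝ) (x : Vars) :
    HasDerivAt (fun m' => F m' x) (fun i => ((systemExpr i).pderiv 8).eval (extend (m, x))) m := by
  refine hasDerivAt_pi.2 fun i => ?_
  simp only [F_apply]
  simpa only [← extend_eq_update] using (systemExpr i).hasDerivAt_eval_update (extend (m, x)) 8 m

theorem differentiable_paramDeriv (m : ℝ) : Differentiable ℝ (paramDeriv m) := by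
  have eval_form : paramDeriv m = fun x i => ((systemExpr i).pderiv 8).eval (extend (m, x)) :=
    funext fun x => (hasDerivAt_F_mass m x).deriv
  rw [eval_form]
  refine ContDiff.differentiable (n := 1) (contDiff_pi.2 fun i => ?_) one_ne_zero
  exact ((systemExpr i).pderiv 8).contDiff_eval.comp
    (extend.contDiff.comp (contDiff_const.prodMk contDiff_id))

theorem paramDeriv_displaced (u : Vars) (y : ℝ) :
    paramDeriv (u 7) (displaced u y)
      = evenVec (blowUpPartial 7 (y ^ 2, u)) + y • oddVec (blowUpPartial 7 (y ^ 2, u)) := by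
  have displaced_update (t : ℝ) : displaced (Function.update u 7 t) y = displaced u y := by
    funext i
    fin_cases i <;> simp [displaced, evenVec_apply, symVec_apply, evenCoords_apply]
  have F_update (t : ℝ) : F t (displaced u y)
      = evenVec (blowUp (y ^ 2, Function.update u 7 t))
        + y • oddVec (blowUp (y ^ 2, Function.update u 7 t)) := by
    simpa [displaced_update] using F_displaced (Function.update u 7 t) y
  have blowUp_deriv := hasDerivAt_blowUp_update (y ^ 2) u 7
  simp only [paramDeriv, F_update]
  exact ((evenVec.hasFDerivAt.comp_hasDerivAt (u 7) blowUp_deriv).add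
    ((oddVec.hasFDerivAt.comp_hasDerivAt (u 7) blowUp_deriv).const_smul y)).deriv

theorem paramDeriv_evenVec (u : Vars) :
    paramDeriv (u 7) (evenVec u) = evenVec (blowUpPartial 7 (0, u)) := by
  simpa [displaced_zero] using paramDeriv_displaced u 0

theorem contDiff_blowUpPartial {n : WithTop ℕ∞} (j : Fin 9) : ContDiff ℝ n (blowUpPartial j) :=
  contDiff_pi.2 fun i => ((blowUpExpr i).pderiv j).contDiff_eval.comp extend.contDiff

theorem fderiv_paramDeriv_antiVec (u : Vars) :
    fderiv ℝ (paramDeriv (u 7)) (evenVec u) (antiVec (u 6, 1))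
      = oddVec (blowUpPartial 7 (0, u)) := by
  have along_displaced : HasDerivAt (fun y => paramDeriv (u 7) (displaced u y))
      (fderiv ℝ (paramDeriv (u 7)) (displaced u 0) (antiVec (u 6, 1))) 0 :=
    (differentiable_paramDeriv _ _).hasFDerivAt.comp_hasDerivAt 0 (hasDerivAt_displaced u 0)
  rw [displaced_zero] at along_displaced
  simp only [paramDeriv_displaced] at along_displaced
  have differentiable_clm (L : Vars →L[ℝ] Vars) :
      Differentiable ℝ fun s => L (blowUpPartial 7 (s, u)) :=
    (L.contDiff.comp ((contDiff_blowUpPartial (n := 1) 7).comp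
      (contDiff_id.prodMk contDiff_const))).differentiable one_ne_zero
  exact along_displaced.unique <| hasDerivAt_comp_sq_add_smul_comp_sq_zero
    (g := fun s => evenVec (blowUpPartial 7 (s, u))) (k := fun s => oddVec (blowUpPartial 7 (s, u)))
    (differentiable_clm _ _) (differentiable_clm _ _)

/-! ### Certified numerics -/

/-- An approximate zero of the blown-up equations at `y = 0`, as multiples of `1 / fixedScale`. -/
def blowUpCenter : Fin 8 → ℤ :=
  ![405856418153143300567391420969599434769545825031071,
    77318950572952558948790758753637139372768650779611,
    101302954384711703524771947907488004027134524341377,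
    57621036528654983921809171052419047386697573279388,
    99527106304736638582196968167704744451622340456733,
    58204027784245088387823968920793181181150086118840,
    35038634147447281283692294006038115785503919857061,
    99229944775238534744984576123263395446564953912555]

/-- The Jacobian matrix of the blown-up equations there, multiplied by `10 ^ 6` and rounded. -/
def jacTable : Matrix (Fin 8) (Fin 8) ℤ :=
  !![0, 0, 2026059, 2287093, 3950428, 1146221, 0, 1317490;
    0, 0, -1408745, 4717897, -2612886, 2249206, 0, 0;
    2079200, -5760514, -5786681, 29449041, -16309591, -1265169, 0, -4235592;
    379678, 3120795, 4763861, 17797558, 4816032, 2816443, 0, -3205144;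
    1956577, -5156533, -7871393, 14368452, -12900094, 14513827, 0, 32125;
    388306, 3036127, -417648, 5747447, 9927394, 14417065, 0, -5522466;
    692633, -3635714, 20127496, -33271694, -21916089, 16063856, 12608688, 1421930;
    5897620, -30957310, 35211110, -87492049, -113648100, 55169938, -13180676, 12107426]

/-- Its inverse, multiplied by `10 ^ 5` and rounded. -/
def jacInvTable : Matrix (Fin 8) (Fin 8) ℤ :=
  !![-152784, -322398, -56893, 111111, 111636, -63254, -2803, -2682;
    -67916, -36408, -25835, 40134, 27031, -21742, -942, -901;
    12712, 2871, 3071, 1871, -6209, 1253, 721, 690;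
    7230, 10713, 2019, -234, -1995, 197, -44, -42;
    12489, -8377, 1827, -4271, -1032, 3488, -239, -228;
    7304, 14054, -188, -3298, -903, 4424, 267, 255;
    0, -427, 1044, -2846, 3759, -1980, 5852, -1989;
    0, -10121, -13542, 13205, 16892, -16578, -548, -524]

/-- The inverse of its symmetric block, multiplied by `10 ^ 5` and rounded. -/
def symInvTable : Matrix (Fin 6) (Fin 6) ℤ :=
  !![-152784, -270616, 12387, 43555, 25216, 21559;
    -67916, -19007, -2555, 17433, -2009, 6758;
    12712, -10446, -14747, 19245, 16017, -20559;
    7230, 11532, 3113, -1302, -3361, 1537;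
    12489, -3966, 7730, -10027, -8395, 10714;
    7304, 9122, -6787, 3136, 7329, -3654]

/-- The derivatives of the blown-up equations in `y²`, multiplied by `10 ^ 6` and rounded. -/
def paramTable : Fin 8 → ℤ :=
  ![2228249, -7186087, 68389480, -29122771, -58379237, 13411879, -58583242, -158756958]

/-- The approximate zero `blowUpCenter` as a real vector. -/
noncomputable def approxZero : Vars := fun j => blowUpCenter j / fixedScale

/-- The points at distance at most `r / fixedScale` from the approximate zero. -/
def approxBall (r : ℤ) : Set Vars := Metric.closedBall approxZero (r / fixedScale)

/-- An enclosure of `extend (0, u)` for `u ∈ approxBall r`. -/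
def centerBall (r : ℤ) : Fin 9 → FixedBall :=
  Fin.snoc (α := fun _ => FixedBall) (fun j => ⟨blowUpCenter j, r⟩) ⟨0, 0⟩

theorem approxBall_mono {r r' : ℤ} (h : r ≤ r') : approxBall r ⊆ approxBall r' :=
  Metric.closedBall_subset_closedBall <|
    div_le_div_of_nonneg_right (Int.cast_le.2 h) fixedScale_cast_pos.le

theorem mem_approxBall_iff {r : ℤ} (hr : 0 ≤ r) {u : Vars} :
    u ∈ approxBall r ↔ ∀ j, |u j * fixedScale - blowUpCenter j| ≤ r := by
  have hN := fixedScale_cast_pos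
  rw [approxBall, Metric.mem_closedBall, dist_pi_le_iff (div_nonneg (Int.cast_nonneg hr) hN.le)]
  refine forall_congr' fun j => ?_
  have scaled : u j * fixedScale - blowUpCenter j = (u j - approxZero j) * fixedScale := by
    rw [approxZero, sub_mul, div_mul_cancel₀ _ hN.ne']
  rw [scaled, abs_mul, abs_of_pos hN, le_div_iff₀ hN, Real.dist_eq]

theorem extend_mem_centerBall {r : ℤ} (hr : 0 ≤ r) {u : Vars} (hu : u ∈ approxBall r) (i : Fin 9) :
    extend (0, u) i ∈ centerBall r i := by
  induction i using Fin.lastCases with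
  | last => exact FixedBall.mem_def.2 (by simp only [centerBall, Fin.snoc_last]; simp)
  | cast j => simpa [FixedBall.mem_def, centerBall] using (mem_approxBall_iff hr).1 hu j

theorem abs_eval_mul_sub_le {r : ℤ} (hr : 0 ≤ r) {u : Vars} (hu : u ∈ approxBall r)
    {e : PolyExpr (Fin 9)} {b t η : ℤ} (hb : 0 < b)
    (h : (e.enclosure (centerBall r)).Within b t η) :
    |e.eval (extend (0, u)) * b - t| ≤ η :=
  h.abs_mul_sub_le hb (eval_mem_enclosure (extend_mem_centerBall hr hu) e)

theorem abs_eval_le_one_div {r : ℤ} (hr : 0 ≤ r) {u : Vars} (hu : u ∈ approxBall r)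
    {e : PolyExpr (Fin 9)} {b : ℤ} (hb : 0 < b)
    (h : (e.enclosure (centerBall r)).Within b 0 1) : |e.eval (extend (0, u))| ≤ 1 / b := by
  have hb' : (0 : ℝ) < b := Int.cast_pos.2 hb
  have scaled := abs_eval_mul_sub_le hr hu hb h
  rwa [Int.cast_zero, sub_zero, Int.cast_one, abs_mul, abs_of_pos hb', ← le_div_iff₀ hb'] at scaled

theorem jacTable_within : ∀ p : Fin 8 × Fin 8,
    (((blowUpExpr p.1).pderiv p.2.castSucc).enclosure (centerBall (10 ^ 40))).Within (10 ^ 6)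
      (jacTable p.1 p.2) 2 := by
  decide +kernel

theorem paramTable_within : ∀ i : Fin 8,
    (((blowUpExpr i).pderiv 8).enclosure (centerBall (10 ^ 10))).Within (10 ^ 6)
      (paramTable i) 2 := by
  decide +kernel

theorem blowUpExpr_within : ∀ i : Fin 8,
    ((blowUpExpr i).enclosure (centerBall 0)).Within (10 ^ 45) 0 1 := by
  decide +kernel

theorem blowUpExpr_six_within :
    ((blowUpExpr 6).enclosure (centerBall (10 ^ 26))).Within (10 ^ 12) 0 1 := by
  decide +kernel

theorem jacInvTable_cert : ∀ i : Fin 8,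
    100 * ∑ j, (|((10 ^ 5 * 10 ^ 6 : ℤ) • (1 : Matrix (Fin 8) (Fin 8) ℤ)
      - jacInvTable * jacTable) i j| + (∑ k, |jacInvTable i k|) * 2) ≤ 10 ^ 5 * 10 ^ 6 := by
  decide +kernel

theorem symInvTable_cert : ∀ i : Fin 6,
    100 * ∑ j, (|((10 ^ 5 * 10 ^ 6 : ℤ) • (1 : Matrix (Fin 6) (Fin 6) ℤ)
      - symInvTable * jacTable.submatrix (Fin.castAdd 2) (Fin.castAdd 2)) i j|
        + (∑ k, |symInvTable i k|) * 2) ≤ 10 ^ 5 * 10 ^ 6 := by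
  decide +kernel

theorem jacInvTable_row_sum_le : ∀ i : Fin 8, ∑ k, |jacInvTable i k| ≤ 10 ^ 6 := by
  decide +kernel

/-- An approximate inverse of the Jacobian matrix of the blown-up equations. -/
noncomputable def jacInv : Matrix (Fin 8) (Fin 8) ℝ :=
  ((10 ^ 5 : ℤ) : ℝ)⁻¹ • jacInvTable.map (Int.cast : ℤ → ℝ)

theorem abs_blowUpJac_mul_sub_le {u : Vars} (hu : u ∈ approxBall (10 ^ 40)) (i j : Fin 8) :
    |blowUpJac (0, u) i j * (10 ^ 6 : ℤ) - jacTable i j| ≤ (2 : ℤ) :=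
  abs_eval_mul_sub_le (by norm_num) hu (by norm_num) (jacTable_within (i, j))

theorem abs_blowUpPartial_eight_mul_sub_le {u : Vars} (hu : u ∈ approxBall (10 ^ 10)) (i : Fin 8) :
    |blowUpPartial 8 (0, u) i * (10 ^ 6 : ℤ) - paramTable i| ≤ (2 : ℤ) :=
  abs_eval_mul_sub_le (by norm_num) hu (by norm_num) (paramTable_within i)

theorem abs_blowUp_approxZero_le (i : Fin 8) : |blowUp (0, approxZero) i| ≤ 1 / 10 ^ 45 :=
  (abs_eval_le_one_div le_rfl (Metric.mem_closedBall_self (by simp)) (by norm_num)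
    (blowUpExpr_within i)).trans_eq (by norm_num)

theorem abs_blowUp_six_le {u : Vars} (hu : u ∈ approxBall (10 ^ 26)) :
    |blowUp (0, u) 6| ≤ 1 / 10 ^ 12 :=
  (abs_eval_le_one_div (by norm_num) hu (by norm_num) blowUpExpr_six_within).trans_eq
    (by norm_num)

theorem twelve_le_blowUpPartial_six {u : Vars} (hu : u ∈ approxBall (10 ^ 40)) :
    12 ≤ blowUpPartial 6 (0, u) 6 := by
  have h := (abs_le.1 (abs_blowUpJac_mul_sub_le hu 6 6)).1
  have entry : jacTable 6 6 = 12608688 := rfl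
  rw [entry] at h
  change _ ≤ blowUpPartial 6 (0, u) 6 * _ - _ at h
  push_cast at h
  linarith

open scoped Matrix.Norms.Operator in
theorem norm_one_sub_jacInv_mul_blowUpJac_le {u : Vars} (hu : u ∈ approxBall (10 ^ 40)) :
    ‖1 - jacInv * blowUpJac (0, u)‖ ≤ 1 / 100 := by
  refine (norm_one_sub_smul_mul_le (by norm_num) (by norm_num) (by norm_num) jacInvTable_cert
    (abs_blowUpJac_mul_sub_le hu)).trans ?_
  norm_num

theorem isUnit_jacInv : IsUnit jacInv :=
  (isUnit_and_isUnit_of_norm_one_sub_mul_lt_one ((norm_one_sub_jacInv_mul_blowUpJac_le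
    (Metric.mem_closedBall_self (by norm_num [fixedScale]))).trans_lt (by norm_num))).1

theorem isUnit_blowUpJac {u : Vars} (hu : u ∈ approxBall (10 ^ 40)) : IsUnit (blowUpJac (0, u)) :=
  (isUnit_and_isUnit_of_norm_one_sub_mul_lt_one
    ((norm_one_sub_jacInv_mul_blowUpJac_le hu).trans_lt (by norm_num))).2

theorem isUnit_symJac {u : Vars} (hu : u ∈ approxBall (10 ^ 40)) : IsUnit (symJac (0, u)) := by
  refine (isUnit_and_isUnit_of_norm_one_sub_mul_lt_one (lt_of_le_of_lt
    (norm_one_sub_smul_mul_le (by norm_num) (by norm_num) (by norm_num) symInvTable_cert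
      fun i j => abs_blowUpJac_mul_sub_le hu (Fin.castAdd 2 i) (Fin.castAdd 2 j)) ?_)).2
  norm_num

open scoped Matrix.Norms.Operator in
theorem norm_jacInv_le : ‖jacInv‖ ≤ 10 := by
  refine norm_matrix_le_of_forall_sum_abs_le (by norm_num) fun i => ?_
  have row_sum : (∑ k, |(jacInvTable i k : ℝ)|) ≤ 10 ^ 6 := by
    exact_mod_cast jacInvTable_row_sum_le i
  calc ∑ k, |jacInv i k| = (100000 : ℝ)⁻¹ * ∑ k, |(jacInvTable i k : ℝ)| := by
        simp [jacInv, abs_mul, Finset.mul_sum]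
    _ ≤ 10 := by linarith

/-! ### The bifurcation point -/

theorem hasFDerivAt_blowUp_right (s : ℝ) (u : Vars) :
    HasFDerivAt (fun u => blowUp (s, u))
      (LinearMap.toContinuousLinearMap (blowUpJac (s, u)).mulVecLin) u := by
  refine ((hasStrictFDerivAt_blowUp (s, u)).hasFDerivAt.comp u
    (hasFDerivAt_prodMk_right s u)).congr_fderiv ?_
  ext1 v
  simp [blowUpDeriv_apply]

open scoped Matrix.Norms.Operator in
theorem norm_jacInv_mulVec_blowUp_approxZero_le :
    ‖jacInv.mulVec (blowUp (0, approxZero))‖ ≤ 1 / 10 ^ 44 := by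
  have residual : ‖blowUp (0, approxZero)‖ ≤ 1 / 10 ^ 45 :=
    (pi_norm_le_iff_of_nonneg (by positivity)).2 abs_blowUp_approxZero_le
  calc ‖jacInv.mulVec (blowUp (0, approxZero))‖ ≤ ‖jacInv‖ * ‖blowUp (0, approxZero)‖ :=
        Matrix.linfty_opNorm_mulVec _ _
    _ ≤ 10 * (1 / 10 ^ 45) := by gcongr; exact norm_jacInv_le
    _ ≤ 1 / 10 ^ 44 := by norm_num

open scoped Matrix.Norms.Operator in
theorem injOn_jacInv_mulVec_blowUp_and_exists_zero :
    Set.InjOn (fun u => jacInv.mulVec (blowUp (0, u))) (approxBall (10 ^ 40)) ∧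
      ∃ u ∈ approxBall (10 ^ 10), jacInv.mulVec (blowUp (0, u)) = 0 := by
  let C : Vars →L[ℝ] Vars := LinearMap.toContinuousLinearMap jacInv.mulVecLin
  let J (u : Vars) : Vars →L[ℝ] Vars :=
    LinearMap.toContinuousLinearMap (blowUpJac (0, u)).mulVecLin
  have near_id : ∀ u ∈ approxBall (10 ^ 40), ‖1 - C ∘L J u‖ ≤ ((1 / 100 : NNReal) : ℝ) := by
    intro u hu
    have C_comp_J : 1 - C ∘L J u = LinearMap.toContinuousLinearMap
        (1 - jacInv * blowUpJac (0, u)).mulVecLin := by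
      ext1 v
      simp [C, J]
    rw [C_comp_J]
    refine (Matrix.linfty_opNorm_eq_opNorm _).symm.trans_le ?_
    exact (norm_one_sub_jacInv_mul_blowUpJac_le hu).trans (by norm_num)
  refine injOn_and_exists_zero_of_norm_one_sub_fderiv_le (c := 1 / 100) ?_
    (fun u _ => C.hasFDerivAt.comp u (hasFDerivAt_blowUp_right 0 u)) near_id
    (div_nonneg (by norm_num) fixedScale_cast_pos.le) ?_ ?_
  · norm_num [← NNReal.coe_lt_coe]
  · exact norm_jacInv_mulVec_blowUp_approxZero_le.trans (by norm_num [fixedScale])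
  · exact div_le_div_of_nonneg_right (by norm_num) fixedScale_cast_pos.le

theorem existsUnique_blowUp_zero :
    ∃ u ∈ approxBall (10 ^ 10), blowUp (0, u) = 0 ∧
      ∀ u' ∈ approxBall (10 ^ 40), blowUp (0, u') = 0 → u' = u := by
  obtain ⟨injOn, u, hu, jacInv_blowUp⟩ := injOn_jacInv_mulVec_blowUp_and_exists_zero
  have hu0 : blowUp (0, u) = 0 :=
    Matrix.mulVec_injective_of_isUnit isUnit_jacInv
      (jacInv_blowUp.trans (Matrix.mulVec_zero _).symm)
  refine ⟨u, hu, hu0, fun u' hu' hu'0 => injOn hu' (approxBall_mono (by norm_num) hu) ?_⟩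
  simp only [hu0, hu'0]

theorem eq_zero_of_evenVec_eq_zero_of_oddVec_eq_zero {b : Vars} (he : evenVec b = 0)
    (ho : oddVec b = 0) : b = 0 := by
  have even_zero : evenCoords b = 0 := by simpa [evenVec_apply] using congrArg symPart he
  have odd_zero : (b 6, b 7) = ((0, 0) : ℝ × ℝ) := by
    simpa [oddVec_apply] using congrArg antiPart ho
  funext i
  refine Fin.addCases (m := 6) (n := 2) (fun j => congrFun even_zero j) (fun j => ?_) i
  fin_cases j
  · exact congrArg Prod.fst odd_zero
  · exact congrArg Prod.snd odd_zero

section Kernel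

variable {u : Vars} (hu : u ∈ approxBall (10 ^ 40))
include hu

theorem eq_antiVec_of_fderiv_F_eq_zero {v : Vars} (hv : fderiv ℝ (F (u 7)) (evenVec u) v = 0) :
    ∃ a b, v = antiVec (a, b) ∧
      (a - b * u 6) * blowUpPartial 6 (0, u) 6 + b * blowUp (0, u) 6 = 0 := by
  rw [← symVec_symPart_add_antiVec_antiPart v, map_add, fderiv_F_symVec,
    ← Prod.mk.eta (p := antiPart v), fderiv_F_antiVec] at hv
  have symPart_zero : symPart v = 0 := by
    refine Matrix.mulVec_injective_of_isUnit (isUnit_symJac hu) ?_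
    simpa [oddVec_apply] using congrArg symPart hv
  refine ⟨(antiPart v).1, (antiPart v).2,
    by simpa [symPart_zero] using (symVec_symPart_add_antiVec_antiPart v).symm, ?_⟩
  simpa [oddVec_apply] using congrArg (fun x => (antiPart x).1) hv

theorem ker_jacobian_eq_span (hu0 : blowUp (0, u) = 0) :
    LinearMap.ker (jacobian (u 7) (evenVec u)).mulVecLin
      = Submodule.span ℝ {antiVec (u 6, 1)} := by
  refine le_antisymm (fun v hv => ?_) ?_
  · rw [LinearMap.mem_ker, Matrix.mulVecLin_apply, jacobian_mulVec] at hv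
    obtain ⟨a, b, rfl, slope_eq⟩ := eq_antiVec_of_fderiv_F_eq_zero hu hv
    have slope_ge := twelve_le_blowUpPartial_six hu
    rw [hu0, Pi.zero_apply, mul_zero, add_zero, mul_eq_zero, sub_eq_zero] at slope_eq
    obtain rfl : a = b * u 6 := slope_eq.resolve_right (by linarith)
    exact Submodule.mem_span_singleton.2 ⟨b, by simp [← map_smul]⟩
  · rw [Submodule.span_singleton_le_iff_mem, LinearMap.mem_ker, Matrix.mulVecLin_apply,
      jacobian_mulVec, fderiv_F_antiVec_slope, hu0, map_zero]

end Kernel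

theorem antiVec_one_ne_zero (a : ℝ) : antiVec (a, 1) ≠ 0 := fun h => by
  simpa using congrArg (fun x => (antiPart x).2) h

theorem isSymmetricSingularSolution {u : Vars} (hu0 : blowUp (0, u) = 0) :
    IsSymmetricSingularSolution (u 7) (evenVec u) where
  r13_eq_r23 := rfl
  r14_eq_r24 := rfl
  solution := by rw [F_evenVec, hu0, map_zero]
  singular := by
    refine Matrix.exists_mulVec_eq_zero_iff.1 ⟨antiVec (u 6, 1), antiVec_one_ne_zero _, ?_⟩
    rw [jacobian_mulVec, fderiv_F_antiVec_slope, hu0, map_zero]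

theorem exists_slope_of_det_eq_zero {u : Vars} (hu : u ∈ approxBall (10 ^ 26))
    (hdet : (jacobian (u 7) (evenVec u)).det = 0) :
    ∃ a : ℝ, |a - u 6| ≤ 1 / 10 ^ 12 ∧ fderiv ℝ (F (u 7)) (evenVec u) (antiVec (a, 1)) = 0 := by
  have hu' : u ∈ approxBall (10 ^ 40) := approxBall_mono (by norm_num) hu
  have slope_ge := twelve_le_blowUpPartial_six hu'
  have odd_le := abs_blowUp_six_le hu
  obtain ⟨v, hv0, hv⟩ := Matrix.exists_mulVec_eq_zero_iff.2 hdet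
  rw [jacobian_mulVec] at hv
  obtain ⟨a, b, rfl, slope_eq⟩ := eq_antiVec_of_fderiv_F_eq_zero hu' hv
  have hb : b ≠ 0 := by
    rintro rfl
    obtain rfl : a = 0 := by
      rw [zero_mul, zero_mul, sub_zero, add_zero, mul_eq_zero] at slope_eq
      exact slope_eq.resolve_right (by linarith)
    exact hv0 (map_zero antiVec)
  refine ⟨a / b, ?_, ?_⟩
  · have deviation : (a / b - u 6) * blowUpPartial 6 (0, u) 6 = -blowUp (0, u) 6 := by
      field_simp
      linarith
    have abs_deviation : |a / b - u 6| * blowUpPartial 6 (0, u) 6 = |blowUp (0, u) 6| := by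
      rw [← abs_neg (blowUp (0, u) 6), ← deviation, abs_mul,
        abs_of_pos (by linarith : 0 < blowUpPartial 6 (0, u) 6)]
    nlinarith [abs_nonneg (a / b - u 6)]
  · have rescaled : antiVec (a / b, 1) = b⁻¹ • antiVec (a, b) := by
      rw [← map_smul]
      simp [hb, div_eq_inv_mul]
    rw [rescaled, map_smul, hv, smul_zero]

theorem coords_mem_approxBall {m : ℝ} {x : Vars} (hbox : InBox m x) {r : ℤ} (hr : 10 ^ 26 ≤ r)
    {a : ℝ} (ha : |a - approxZero 6| ≤ r / fixedScale) :
    coords (symPart x) a m ∈ approxBall r := by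
  have hr' : (10 ^ 26 : ℝ) ≤ r := by exact_mod_cast hr
  have scale : (fixedScale : ℝ) = 10 ^ 50 := by norm_num [fixedScale]
  obtain ⟨hx, hm⟩ := hbox
  have radius_le : 1 / 10 ^ 24 ≤ (r : ℝ) / fixedScale := by
    rw [scale, le_div_iff₀ (by positivity)]
    linarith
  refine (dist_pi_le_iff ((by positivity : (0 : ℝ) ≤ 1 / 10 ^ 24).trans radius_le)).2 fun j => ?_
  rw [Real.dist_eq]
  by_cases hj : j = 6
  · subst hj
    exact ha
  refine le_trans ?_ radius_le
  simp only [Fin.forall_fin_succ, center, radius, abs_le] at hx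
  rw [abs_le] at hm ⊢
  fin_cases j <;> simp [approxZero, blowUpCenter, coords, symPart_apply, scale] at hx hj ⊢ <;>
    constructor <;> linarith

theorem inBox_evenVec {u : Vars} (hu : u ∈ approxBall (10 ^ 10)) : InBox (u 7) (evenVec u) := by
  have near := (mem_approxBall_iff (by norm_num)).1 hu
  have scale : (fixedScale : ℝ) = 10 ^ 50 := by norm_num [fixedScale]
  obtain ⟨h0, h1, h2, h3, h4, h5, -, h7⟩ : _ ∧ _ ∧ _ ∧ _ ∧ _ ∧ _ ∧ _ ∧ _ :=
    ⟨near 0, near 1, near 2, near 3, near 4, near 5, near 6, near 7⟩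
  simp only [blowUpCenter, Matrix.cons_val, abs_le, scale] at h0 h1 h2 h3 h4 h5 h7
  push_cast at h0 h1 h2 h3 h4 h5 h7
  refine ⟨fun i => ?_, ?_⟩ <;> rw [abs_le]
  · fin_cases i <;> simp [evenVec_apply, symVec_apply, evenCoords_apply, center, radius] <;>
      constructor <;> linarith
  · constructor <;> linarith

theorem exists_blowUp_zero_of_isSymmetricSingularSolution {m : ℝ} {x : Vars} (hbox : InBox m x)
    (hx : IsSymmetricSingularSolution m x) :
    ∃ u ∈ approxBall (10 ^ 40), blowUp (0, u) = 0 ∧ u 7 = m ∧ evenVec u = x := by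
  have evenVec_eq (a : ℝ) : evenVec (coords (symPart x) a m) = x :=
    (evenVec_coords _ _ _).trans (symVec_symPart hx.r13_eq_r23 hx.r14_eq_r24)
  have near : coords (symPart x) (approxZero 6) m ∈ approxBall (10 ^ 26) :=
    coords_mem_approxBall hbox le_rfl (by norm_num [fixedScale])
  obtain ⟨a, ha, hker⟩ := exists_slope_of_det_eq_zero near (by rw [evenVec_eq]; exact hx.singular)
  have odd_zero := fderiv_F_antiVec_slope (coords (symPart x) a m)
  rw [evenVec_eq] at hker odd_zero
  have even_zero := F_evenVec (coords (symPart x) a m)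
  rw [evenVec_eq] at even_zero
  refine ⟨coords (symPart x) a m, coords_mem_approxBall hbox (by norm_num) ?_,
    eq_zero_of_evenVec_eq_zero_of_oddVec_eq_zero (even_zero.symm.trans hx.solution)
      (odd_zero.symm.trans hker), rfl, evenVec_eq a⟩
  exact ha.trans (by norm_num [fixedScale])

/-! ### The coefficients of the normal form -/

/-- The slope of the left kernel vector of the Jacobian matrix. -/
noncomputable def leftSlope (u : Vars) : ℝ :=
  -(blowUpPartial 6 (0, u) 7 / blowUpPartial 6 (0, u) 6)

theorem antiVec_dotProduct_oddVec (q : ℝ × ℝ) (b : Vars) :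
    antiVec q ⬝ᵥ oddVec b = 2 * (q.1 * b 6 + q.2 * b 7) := by
  rw [antiVec_dotProduct, oddVec_apply, antiPart_antiVec]

theorem antiVec_dotProduct_evenVec (q : ℝ × ℝ) (b : Vars) : antiVec q ⬝ᵥ evenVec b = 0 := by
  simp [antiVec_dotProduct, evenVec_apply]

theorem leftSlope_within :
    ((const (10 ^ 22) * (blowUpExpr 7).pderiv 6
      + const 10453646029495395551308 * (blowUpExpr 6).pderiv 6).enclosure
        (centerBall (10 ^ 10))).Within 1 0 12 := by
  decide +kernel

theorem mixed_within :
    ((const (2 * 10 ^ 19) * ((blowUpExpr 7).pderiv 7 * (blowUpExpr 6).pderiv 6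
        - (blowUpExpr 7).pderiv 6 * (blowUpExpr 6).pderiv 7)
      - const 271877227151147526097 * (blowUpExpr 6).pderiv 6).enclosure
        (centerBall (10 ^ 10))).Within 1 0 12 := by
  decide +kernel

theorem cubic_within :
    ((const (12 * 10 ^ 16) * ((blowUpExpr 7).pderiv 8 * (blowUpExpr 6).pderiv 6
        - (blowUpExpr 7).pderiv 6 * (blowUpExpr 6).pderiv 8)
      + const 26399736664601674948 * (blowUpExpr 6).pderiv 6).enclosure
        (centerBall (10 ^ 10))).Within 1 0 12 := by
  decide +kernel

section

variable {u : Vars}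

theorem leftSlope_mul (hu : u ∈ approxBall (10 ^ 40)) :
    leftSlope u * blowUpPartial 6 (0, u) 6 = -blowUpPartial 6 (0, u) 7 := by
  have slope_ge := twelve_le_blowUpPartial_six hu
  rw [leftSlope, neg_mul, div_mul_cancel₀ _ (by linarith)]

theorem antiVec_leftSlope_vecMul_jacobian (hu : u ∈ approxBall (10 ^ 40))
    (hu0 : blowUp (0, u) = 0) :
    Matrix.vecMul (antiVec (leftSlope u, 1)) (jacobian (u 7) (evenVec u)) = 0 := by
  refine dotProduct_eq_zero_iff.1 fun v => ?_
  rw [← Matrix.dotProduct_mulVec, jacobian_mulVec, ← symVec_symPart_add_antiVec_antiPart v, map_add,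
    fderiv_F_symVec, ← Prod.mk.eta (p := antiPart v), fderiv_F_antiVec, hu0, map_zero, smul_zero,
    add_zero, dotProduct_add, dotProduct_smul, antiVec_dotProduct_oddVec, leftSlope_mul hu]
  simp [antiVec_dotProduct]

theorem abs_eval_le {e : PolyExpr (Fin 9)} {η : ℤ} (hu : u ∈ approxBall (10 ^ 10))
    (h : (e.enclosure (centerBall (10 ^ 10))).Within 1 0 η) : |e.eval (extend (0, u))| ≤ η := by
  simpa using abs_eval_mul_sub_le (by norm_num) hu one_pos h

theorem abs_leftSlope_sub_le (hu : u ∈ approxBall (10 ^ 10)) :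
    |leftSlope u - 1.0453646029495395551308| ≤ 1 / 10 ^ 22 := by
  have hu' : u ∈ approxBall (10 ^ 40) := approxBall_mono (by norm_num) hu
  have slope_ge := twelve_le_blowUpPartial_six hu'
  have scaled : |(10 ^ 22 * leftSlope u - 10453646029495395551308) * blowUpPartial 6 (0, u) 6|
      ≤ 12 := by
    rw [← abs_neg]
    convert abs_eval_le hu leftSlope_within using 2
    · simp only [eval_add, eval_mul, eval_const, ← blowUpPartial_apply]
      push_cast
      linear_combination -10 ^ 22 * leftSlope_mul hu'
    · norm_num
  convert abs_sub_div_le_of_abs_mul_sub_mul_le (by positivity) (by linarith) slope_ge scaled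
    using 2
  norm_num

theorem abs_mixed_sub_le (hu : u ∈ approxBall (10 ^ 10)) :
    |antiVec (leftSlope u, 1) ⬝ᵥ oddVec (blowUpPartial 7 (0, u)) - 27.1877227151147526097|
      ≤ 1 / 10 ^ 19 := by
  have hu' : u ∈ approxBall (10 ^ 40) := approxBall_mono (by norm_num) hu
  have slope_ge := twelve_le_blowUpPartial_six hu'
  rw [antiVec_dotProduct_oddVec]
  have scaled : |(10 ^ 19 * (2 * (leftSlope u * blowUpPartial 7 (0, u) 6
      + 1 * blowUpPartial 7 (0, u) 7)) - 271877227151147526097) * blowUpPartial 6 (0, u) 6|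
      ≤ 12 := by
    convert abs_eval_le hu mixed_within using 2
    · simp only [eval_sub, eval_mul, eval_const, ← blowUpPartial_apply]
      push_cast
      linear_combination 2 * 10 ^ 19 * blowUpPartial 7 (0, u) 6 * leftSlope_mul hu'
    · norm_num
  convert abs_sub_div_le_of_abs_mul_sub_mul_le (by positivity) (by linarith) slope_ge scaled
    using 2
  norm_num

theorem abs_cubic_sub_le (hu : u ∈ approxBall (10 ^ 10)) :
    |antiVec (leftSlope u, 1) ⬝ᵥ ((6 : ℝ) • oddVec (blowUpPartial 8 (0, u)))
        - (-2639.9736664601674948)| ≤ 1 / 10 ^ 16 := by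
  have hu' : u ∈ approxBall (10 ^ 40) := approxBall_mono (by norm_num) hu
  have slope_ge := twelve_le_blowUpPartial_six hu'
  rw [dotProduct_smul, antiVec_dotProduct_oddVec]
  have scaled : |(10 ^ 16 * ((6 : ℝ) • (2 * (leftSlope u * blowUpPartial 8 (0, u) 6
      + 1 * blowUpPartial 8 (0, u) 7))) - -26399736664601674948) * blowUpPartial 6 (0, u) 6|
      ≤ 12 := by
    convert abs_eval_le hu cubic_within using 2
    · simp only [eval_add, eval_sub, eval_mul, eval_const, smul_eq_mul,
        ← blowUpPartial_apply]
      push_cast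
      linear_combination 12 * 10 ^ 16 * blowUpPartial 8 (0, u) 6 * leftSlope_mul hu'
    · norm_num
  convert abs_sub_div_le_of_abs_mul_sub_mul_le (by positivity) (by linarith) slope_ge scaled
    using 2
  norm_num

theorem abs_slope_sub_le (hu : u ∈ approxBall (10 ^ 10)) :
    |u 6 - 0.3503863414744728128369| ≤ 1 / 10 ^ 22 := by
  have near := (mem_approxBall_iff (by norm_num)).1 hu 6
  simp only [blowUpCenter, Matrix.cons_val, fixedScale, abs_le] at near
  push_cast at near
  rw [abs_le]
  constructor <;> linarith

theorem antiVec_leftSlope_dotProduct_antiVec_slope_ne_zero (hu : u ∈ approxBall (10 ^ 10)) :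
    antiVec (leftSlope u, 1) ⬝ᵥ antiVec (u 6, 1) ≠ 0 := by
  have left_pos : 0 < leftSlope u := by linarith [(abs_le.1 (abs_leftSlope_sub_le hu)).1]
  have slope_pos : 0 < u 6 := by linarith [(abs_le.1 (abs_slope_sub_le hu)).1]
  rw [antiVec_dotProduct, antiPart_antiVec]
  positivity

theorem jacInvTable_mulVec_paramTable :
    (∀ i : Fin 8, |jacInvTable.mulVec paramTable i| ≤ 129 * 10 ^ 11) ∧
      jacInvTable.mulVec paramTable 7 ≤ -21 * 10 ^ 11 := by
  decide +kernel

open scoped Matrix.Norms.Operator in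
theorem abs_jacInv_mulVec_blowUpPartial_eight_sub_le (hu : u ∈ approxBall (10 ^ 10)) (i : Fin 8) :
    |jacInv.mulVec (blowUpPartial 8 (0, u)) i
      - (jacInvTable.mulVec paramTable i : ℝ) / 10 ^ 11| ≤ 1 := by
  let approxPartial : Vars := fun k => paramTable k / 10 ^ 6
  have jacInv_approx : jacInv.mulVec approxPartial i
      = (jacInvTable.mulVec paramTable i : ℝ) / 10 ^ 11 := by
    simp only [jacInv, Matrix.smul_apply, Matrix.map_apply, Matrix.mulVec, dotProduct,
      approxPartial, smul_eq_mul]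
    push_cast
    rw [Finset.sum_div]
    exact Finset.sum_congr rfl fun k _ => by ring
  have error_le : ‖blowUpPartial 8 (0, u) - approxPartial‖ ≤ 2 / 10 ^ 6 := by
    refine (pi_norm_le_iff_of_nonneg (by positivity)).2 fun k => ?_
    have h := abs_blowUpPartial_eight_mul_sub_le hu k
    push_cast at h
    rw [abs_le] at h
    simp only [Pi.sub_apply, approxPartial, Real.norm_eq_abs, abs_le]
    constructor <;> linarith
  calc |jacInv.mulVec (blowUpPartial 8 (0, u)) i
        - (jacInvTable.mulVec paramTable i : ℝ) / 10 ^ 11|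
      = ‖jacInv.mulVec (blowUpPartial 8 (0, u) - approxPartial) i‖ := by
        rw [← jacInv_approx, Matrix.mulVec_sub, Pi.sub_apply, Real.norm_eq_abs]
    _ ≤ ‖jacInv‖ * ‖blowUpPartial 8 (0, u) - approxPartial‖ :=
        (norm_le_pi_norm _ i).trans (Matrix.linfty_opNorm_mulVec _ _)
    _ ≤ 10 * (2 / 10 ^ 6) := by gcongr; exact norm_jacInv_le
    _ ≤ 1 := by norm_num

theorem norm_jacInv_mulVec_blowUpPartial_eight_le (hu : u ∈ approxBall (10 ^ 10)) :
    ‖jacInv.mulVec (blowUpPartial 8 (0, u))‖ ≤ 130 := by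
  refine (pi_norm_le_iff_of_nonneg (by norm_num)).2 fun i => ?_
  have error_le := abs_le.1 (abs_jacInv_mulVec_blowUpPartial_eight_sub_le hu i)
  have table_le : |(jacInvTable.mulVec paramTable i : ℝ)| ≤ 129 * 10 ^ 11 := by
    exact_mod_cast jacInvTable_mulVec_paramTable.1 i
  rw [abs_le] at table_le
  rw [Real.norm_eq_abs, abs_le]
  constructor <;> linarith

theorem jacInv_mulVec_blowUpPartial_eight_seven_le (hu : u ∈ approxBall (10 ^ 10)) :
    jacInv.mulVec (blowUpPartial 8 (0, u)) 7 ≤ -20 := by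
  have error_le := abs_le.1 (abs_jacInv_mulVec_blowUpPartial_eight_sub_le hu 7)
  have table_le : (jacInvTable.mulVec paramTable 7 : ℝ) ≤ -21 * 10 ^ 11 := by
    exact_mod_cast jacInvTable_mulVec_paramTable.2
  linarith

open scoped Matrix.Norms.Operator in
theorem mass_pos_of_blowUpPartial_add_blowUpJac_mulVec_eq_zero (hu : u ∈ approxBall (10 ^ 10))
    {v : Vars} (hv : blowUpPartial 8 (0, u) + (blowUpJac (0, u)).mulVec v = 0) : 0 < v 7 := by
  set κ := jacInv.mulVec (blowUpPartial 8 (0, u))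
  have approx : ‖v + κ‖ ≤ 1 / 100 * ‖v‖ :=
    calc ‖v + κ‖ = ‖(1 - jacInv * blowUpJac (0, u)).mulVec v‖ := by
          rw [Matrix.sub_mulVec, Matrix.one_mulVec, ← Matrix.mulVec_mulVec,
            eq_neg_of_add_eq_zero_right hv, Matrix.mulVec_neg, sub_neg_eq_add]
      _ ≤ ‖1 - jacInv * blowUpJac (0, u)‖ * ‖v‖ := Matrix.linfty_opNorm_mulVec _ _
      _ ≤ 1 / 100 * ‖v‖ := by
          gcongr
          exact norm_one_sub_jacInv_mul_blowUpJac_le (approxBall_mono (by norm_num) hu)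
  have norm_κ : ‖κ‖ ≤ 130 := norm_jacInv_mulVec_blowUpPartial_eight_le hu
  have κ_seven : κ 7 ≤ -20 := jacInv_mulVec_blowUpPartial_eight_seven_le hu
  have norm_v : ‖v‖ ≤ ‖v + κ‖ + ‖κ‖ := by simpa using norm_sub_le (v + κ) κ
  have deviation := (abs_le.1 ((norm_le_pi_norm (v + κ) 7).trans approx)).1
  rw [Pi.add_apply] at deviation
  linarith

end

/-! ### The branches of solutions -/

open Asymptotics Filter

theorem antiPart_F_symVec (m : ℝ) (p : Fin 6 → ℝ) : antiPart (F m (symVec p)) = 0 := by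
  have h := F_evenVec (coords p 0 m)
  rw [evenVec_coords, evenVec_apply] at h
  exact (congrArg antiPart h).trans (antiPart_symVec _)

theorem F_symVec_eq_zero_iff {m : ℝ} {p : Fin 6 → ℝ} :
    F m (symVec p) = 0 ↔ symPart (F m (symVec p)) = 0 := by
  refine ⟨fun h => by rw [h, map_zero], fun h => ?_⟩
  rw [← symVec_symPart_add_antiVec_antiPart (F m (symVec p)), h, antiPart_F_symVec, map_zero,
    map_zero, add_zero]

theorem F_displaced_eq_zero_iff {u : Vars} {y : ℝ} (hy : y ≠ 0) :
    F (u 7) (displaced u y) = 0 ↔ blowUp (y ^ 2, u) = 0 := by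
  rw [F_displaced]
  refine ⟨fun h => eq_zero_of_evenVec_eq_zero_of_oddVec_eq_zero ?_ ?_, fun h => by simp [h]⟩
  · simpa [evenVec_apply, oddVec_apply] using congrArg (symVec ∘L symPart) h
  · have odd_half : y • (blowUp (y ^ 2, u) 6, blowUp (y ^ 2, u) 7) = 0 := by
      simpa [evenVec_apply, oddVec_apply] using congrArg antiPart h
    rw [oddVec_apply, (smul_eq_zero.1 odd_half).resolve_left hy, map_zero]

/-- The coordinate `y` of a displaced configuration. -/
noncomputable def displacement : Vars →L[ℝ] ℝ := ContinuousLinearMap.snd ℝ ℝ ℝ ∘L antiPart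

theorem displacement_apply (x : Vars) : displacement x = (antiPart x).2 := rfl

@[simp] theorem displacement_symVec (p : Fin 6 → ℝ) : displacement (symVec p) = 0 := by
  simp [displacement_apply]

@[simp] theorem displacement_evenVec (u : Vars) : displacement (evenVec u) = 0 :=
  displacement_symVec _

@[simp] theorem displacement_displaced (u : Vars) (y : ℝ) :
    displacement (displaced u y) = y := by
  simp [displacement_apply, displaced, evenVec_apply]

@[simp] theorem coords_evenCoords (u : Vars) : coords (evenCoords u) (u 6) (u 7) = u := by
  funext i
  fin_cases i <;> rfl

theorem continuous_coords :
    Continuous fun q : (Fin 6 → ℝ) × ℝ × ℝ => coords q.1 q.2.1 q.2.2 := by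
  refine continuous_pi fun i => ?_
  fin_cases i <;> simp only [coords] <;> fun_prop

theorem displaced_coords {x : Vars} (hx : displacement x ≠ 0) (m : ℝ) :
    displaced (coords (symPart x) ((antiPart x).1 / displacement x) m) (displacement x) = x := by
  have rescaled : displacement x • ((antiPart x).1 / displacement x, (1 : ℝ)) = antiPart x := by
    ext
    · simp [mul_div_cancel₀ _ hx]
    · simp [displacement_apply]
  conv_rhs => rw [← symVec_symPart_add_antiVec_antiPart x, ← rescaled, map_smul]
  rw [displaced, evenVec_coords]
  rfl

theorem hasFDerivAt_symPart_F_symVec (u : Vars) :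
    HasFDerivAt (fun p => symPart (F (u 7) (symVec p)))
      (LinearMap.toContinuousLinearMap (symJac (0, u)).mulVecLin) (evenCoords u) := by
  have along_symVec : HasFDerivAt (fun p => F (u 7) (symVec p))
      (fderiv ℝ (F (u 7)) (symVec (evenCoords u)) ∘L symVec) (evenCoords u) :=
    (hasFDerivAt_F (u 7) (symVec (evenCoords u))).comp (evenCoords u) symVec.hasFDerivAt
  have symmetric_half : HasFDerivAt (fun p => symPart (F (u 7) (symVec p)))
      (symPart ∘L fderiv ℝ (F (u 7)) (symVec (evenCoords u)) ∘L symVec) (evenCoords u) :=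
    symPart.hasFDerivAt.comp (evenCoords u) along_symVec
  refine symmetric_half.congr_fderiv ?_
  ext1 p
  simp [← evenVec_apply, fderiv_F_symVec]

theorem exists_symmetric_branch {u : Vars} (hu : u ∈ approxBall (10 ^ 40))
    (hu0 : blowUp (0, u) = 0) :
    ∃ ψ : ℝ → Fin 6 → ℝ, ContDiffAt ℝ ω ψ (u 7) ∧ ψ (u 7) = evenCoords u ∧
      ∀ᶠ p : ℝ × (Fin 6 → ℝ) in 𝓝 (u 7, evenCoords u), F p.1 (symVec p.2) = 0 ↔ ψ p.1 = p.2 := by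
  have smooth : ContDiff ℝ ω fun p : ℝ × (Fin 6 → ℝ) => symPart (F p.1 (symVec p.2)) :=
    symPart.contDiff.comp (contDiff_F.comp (f := fun p : ℝ × (Fin 6 → ℝ) => (p.1, symVec p.2))
      (contDiff_fst.prodMk (symVec.contDiff.comp contDiff_snd)))
  simp only [F_symVec_eq_zero_iff]
  refine exists_implicit_branch (f := fun p : ℝ × (Fin 6 → ℝ) => symPart (F p.1 (symVec p.2)))
    (f' := LinearMap.toContinuousLinearMap (symJac (0, u)).mulVecLin) (by decide)
    smooth.contDiffAt ?_ ?_
    (Matrix.mulVec_injective_of_isUnit (isUnit_symJac hu))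
  · have zero_at : F (u 7) (evenVec u) = 0 := by rw [F_evenVec, hu0, map_zero]
    exact (congrArg symPart zero_at).trans (map_zero symPart)
  · exact hasFDerivAt_symPart_F_symVec u

theorem exists_asymmetric_branch {u : Vars} (hu : u ∈ approxBall (10 ^ 40))
    (hu0 : blowUp (0, u) = 0) :
    ∃ φ : ℝ → Vars, ContDiffAt ℝ ω φ 0 ∧ φ 0 = u ∧
      ∀ᶠ p in 𝓝 (0, u), blowUp p = 0 ↔ φ p.1 = p.2 :=
  exists_implicit_branch (by decide) contDiff_blowUp.contDiffAt hu0 (hasFDerivAt_blowUp_right 0 u)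
    (Matrix.mulVec_injective_of_isUnit (isUnit_blowUpJac hu))

theorem deriv_mass_pos {u : Vars} (hu : u ∈ approxBall (10 ^ 10)) {φ : ℝ → Vars}
    (hφ : DifferentiableAt ℝ φ 0) (hφ0 : φ 0 = u) (hzero : ∀ᶠ t in 𝓝 0, blowUp (t, φ t) = 0) :
    0 < deriv (fun t => φ t 7) 0 := by
  rw [(hasDerivAt_pi.1 hφ.hasDerivAt 7).deriv]
  refine mass_pos_of_blowUpPartial_add_blowUpJac_mulVec_eq_zero hu ?_
  have along_branch := hasDerivAt_blowUp_comp ((hasDerivAt_id (0 : ℝ)).prodMk hφ.hasDerivAt)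
  have zero_deriv : HasDerivAt (fun t => blowUp (t, φ t)) 0 0 :=
    (hasDerivAt_const 0 0).congr_of_eventuallyEq hzero
  simpa [hφ0] using along_branch.unique zero_deriv

/-! ### Every nearby solution lies on a branch -/

theorem fderiv_F_prod_apply (m : ℝ) (x v : Vars) :
    fderiv ℝ (fun p : ℝ × Vars => F p.1 p.2) (m, x) (0, v) = fderiv ℝ (F m) x v := by
  have total := ((contDiff_F (n := 1)).differentiable one_ne_zero (m, x)).hasFDerivAt
  have partial_right := total.comp x (hasFDerivAt_prodMk_right m x)
  rw [(hasFDerivAt_F m x).unique partial_right]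
  simp

variable {u : Vars}

/-- Strict differentiability of `F` is applied to a solution and its symmetrization: the
antisymmetric part of `F` vanishes at both. -/
theorem isLittleO_slope_deviation_antiPart (hu : u ∈ approxBall (10 ^ 40))
    (hu0 : blowUp (0, u) = 0) :
    (fun p : ℝ × Vars => (antiPart p.2).1 - (antiPart p.2).2 * u 6)
      =o[𝓝[{p | F p.1 p.2 = 0}] (u 7, evenVec u)] fun p => antiPart p.2 := by
  have slope_ge := twelve_le_blowUpPartial_six hu
  have symmetrize : Tendsto (fun p : ℝ × Vars => (p, (p.1, symVec (symPart p.2))))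
      (𝓝[{p | F p.1 p.2 = 0}] (u 7, evenVec u)) (𝓝 ((u 7, evenVec u), (u 7, evenVec u))) := by
    have continuous : Continuous fun p : ℝ × Vars => (p, (p.1, symVec (symPart p.2))) := by fun_prop
    refine tendsto_nhdsWithin_of_tendsto_nhds ?_
    simpa [evenVec_apply] using continuous.tendsto (u 7, evenVec u)
  have remainder := (((contDiff_F (n := 1)).contDiffAt.hasStrictFDerivAt
    one_ne_zero).isLittleO.comp_tendsto symmetrize)
  have difference (p : ℝ × Vars) : p - (p.1, symVec (symPart p.2)) = (0, antiVec (antiPart p.2)) :=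
    Prod.ext (sub_self _) (sub_eq_of_eq_add' (symVec_symPart_add_antiVec_antiPart p.2).symm)
  have antiVec_isBigO : (fun p : ℝ × Vars => ((0 : ℝ), antiVec (antiPart p.2)))
      =O[𝓝[{p | F p.1 p.2 = 0}] (u 7, evenVec u)] fun p => antiPart p.2 :=
    (ContinuousLinearMap.inr ℝ ℝ Vars ∘L antiVec).isBigO_comp _ _
  simp only [Function.comp_def, difference] at remainder
  have odd_remainder := (((ContinuousLinearMap.fst ℝ ℝ ℝ ∘L antiPart).isBigO_comp _
    _).trans_isLittleO remainder).trans_isBigO antiVec_isBigO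
  rw [← isLittleO_const_mul_left_iff (by linarith : -blowUpPartial 6 (0, u) 6 ≠ 0)]
  refine odd_remainder.congr' ?_ EventuallyEq.rfl
  filter_upwards [self_mem_nhdsWithin] with p (hp : F p.1 p.2 = 0)
  rw [fderiv_F_prod_apply, ← Prod.mk.eta (p := antiPart p.2), fderiv_F_antiVec, hu0]
  simp [hp, antiPart_F_symVec, oddVec_apply, mul_comm]

theorem isLittleO_slope_deviation (hu : u ∈ approxBall (10 ^ 40)) (hu0 : blowUp (0, u) = 0) :
    (fun p : ℝ × Vars => (antiPart p.2).1 - displacement p.2 * u 6)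
      =o[𝓝[{p | F p.1 p.2 = 0}] (u 7, evenVec u)] fun p => displacement p.2 := by
  have deviation := isLittleO_slope_deviation_antiPart hu hu0
  have equivalent : (fun p : ℝ × Vars => displacement p.2 • (u 6, (1 : ℝ)))
      ~[𝓝[{p | F p.1 p.2 = 0}] (u 7, evenVec u)] fun p => antiPart p.2 := by
    refine (((ContinuousLinearMap.inl ℝ ℝ ℝ).isBigO_comp _ _).trans_isLittleO
      deviation.neg_left).congr_left fun p => ?_
    ext <;> simp [displacement_apply]
  refine deviation.trans_isBigO (equivalent.isBigO_symm.trans ?_)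
  exact (ContinuousLinearMap.toSpanSingleton ℝ (u 6, (1 : ℝ))).isBigO_comp _ _

theorem tendsto_slope (hu : u ∈ approxBall (10 ^ 40)) (hu0 : blowUp (0, u) = 0) :
    Tendsto (fun p : ℝ × Vars => (antiPart p.2).1 / displacement p.2)
      (𝓝[{p | F p.1 p.2 = 0 ∧ displacement p.2 ≠ 0}] (u 7, evenVec u)) (𝓝 (u 6)) := by
  have deviation := ((isLittleO_slope_deviation hu hu0).mono (nhdsWithin_mono _
    fun p (hp : F p.1 p.2 = 0 ∧ displacement p.2 ≠ 0) => hp.1)).tendsto_div_nhds_zero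
  rw [← zero_add (u 6)]
  refine (deviation.add_const (u 6)).congr' ?_
  filter_upwards [self_mem_nhdsWithin] with p hp
  rw [sub_div, mul_div_cancel_left₀ _ hp.2, sub_add_cancel]

theorem tendsto_blowUpCoords (hu : u ∈ approxBall (10 ^ 40)) (hu0 : blowUp (0, u) = 0) :
    Tendsto (fun p : ℝ × Vars => (displacement p.2 ^ 2,
        coords (symPart p.2) ((antiPart p.2).1 / displacement p.2) p.1))
      (𝓝[{p | F p.1 p.2 = 0 ∧ displacement p.2 ≠ 0}] (u 7, evenVec u)) (𝓝 (0, u)) := by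
  have tendsto_of_continuous {Y : Type} [TopologicalSpace Y] {f : ℝ × Vars → Y}
      (hf : Continuous f) : Tendsto f
        (𝓝[{p | F p.1 p.2 = 0 ∧ displacement p.2 ≠ 0}] (u 7, evenVec u))
        (𝓝 (f (u 7, evenVec u))) :=
    tendsto_nhdsWithin_of_tendsto_nhds (hf.tendsto _)
  refine Tendsto.prodMk_nhds ?_ ?_
  · have limit := tendsto_of_continuous (f := fun p => displacement p.2 ^ 2) (by fun_prop)
    rwa [displacement_evenVec, zero_pow two_ne_zero] at limit
  · have symPart_limit := tendsto_of_continuous (f := fun p => symPart p.2) (by fun_prop)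
    have limit := (continuous_coords.tendsto _).comp (symPart_limit.prodMk_nhds
      ((tendsto_slope hu hu0).prodMk_nhds (tendsto_of_continuous continuous_fst)))
    simpa [Function.comp_def, evenVec_apply] using limit

theorem eventually_eq_displaced (hu : u ∈ approxBall (10 ^ 40)) (hu0 : blowUp (0, u) = 0)
    {φ : ℝ → Vars} (hφ : ∀ᶠ p in 𝓝 (0, u), blowUp p = 0 ↔ φ p.1 = p.2) :
    ∀ᶠ p in 𝓝 (u 7, evenVec u), F p.1 p.2 = 0 → displacement p.2 ≠ 0 →
      p.2 = displaced (φ (displacement p.2 ^ 2)) (displacement p.2) ∧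
        p.1 = φ (displacement p.2 ^ 2) 7 := by
  have blown_up := eventually_nhdsWithin_iff.1 ((tendsto_blowUpCoords hu hu0).eventually hφ)
  filter_upwards [blown_up] with ⟨m, x⟩ hp hF hy
  have reassemble := displaced_coords hy m
  have on_branch := (hp ⟨hF, hy⟩).1 ((F_displaced_eq_zero_iff hy).1 (by rw [reassemble]; exact hF))
  exact ⟨by rw [on_branch, reassemble], by rw [on_branch]; rfl⟩

theorem eventually_eq_symVec (hu : u ∈ approxBall (10 ^ 40)) (hu0 : blowUp (0, u) = 0)
    {ψ : ℝ → Fin 6 → ℝ} (hψ : ∀ᶠ p : ℝ × (Fin 6 → ℝ) in 𝓝 (u 7, evenCoords u),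
      F p.1 (symVec p.2) = 0 ↔ ψ p.1 = p.2) :
    ∀ᶠ p in 𝓝 (u 7, evenVec u), F p.1 p.2 = 0 → displacement p.2 = 0 →
      p.2 = symVec (ψ p.1) := by
  have deviation_zero := eventually_nhdsWithin_iff.1
    (isLittleO_slope_deviation hu hu0).isBigO.eq_zero_imp
  have symmetric_part : Tendsto (fun p : ℝ × Vars => (p.1, symPart p.2)) (𝓝 (u 7, evenVec u))
      (𝓝 (u 7, evenCoords u)) := by
    have continuous : Continuous fun p : ℝ × Vars => (p.1, symPart p.2) := by fun_prop
    simpa [evenVec_apply] using continuous.tendsto (u 7, evenVec u)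
  filter_upwards [deviation_zero, symmetric_part.eventually hψ] with ⟨m, x⟩ hdev hbranch hF hy
  have antiPart_zero : antiPart x = 0 := by
    refine Prod.ext ?_ hy
    simpa [hy] using hdev hF hy
  have symmetric : x = symVec (symPart x) := by
    simpa [antiPart_zero] using (symVec_symPart_add_antiVec_antiPart x).symm
  rw [symmetric] at hF
  rw [hbranch.1 hF, ← symmetric]

theorem eventually_F_eq_zero_iff (hu : u ∈ approxBall (10 ^ 40)) (hu0 : blowUp (0, u) = 0)
    {ψ : ℝ → Fin 6 → ℝ} (hψ : ContinuousAt ψ (u 7)) (hψ0 : ψ (u 7) = evenCoords u)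
    (hψF : ∀ᶠ p : ℝ × (Fin 6 → ℝ) in 𝓝 (u 7, evenCoords u), F p.1 (symVec p.2) = 0 ↔ ψ p.1 = p.2)
    {φ : ℝ → Vars} (hφ : ContinuousAt φ 0) (hφ0 : φ 0 = u)
    (hφF : ∀ᶠ p in 𝓝 (0, u), blowUp p = 0 ↔ φ p.1 = p.2) :
    ∀ᶠ p in 𝓝 (u 7, evenVec u), F p.1 p.2 = 0 ↔ p.2 = symVec (ψ p.1) ∨
      (p.2 = displaced (φ (displacement p.2 ^ 2)) (displacement p.2) ∧
        p.1 = φ (displacement p.2 ^ 2) 7) := by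
  have tendsto_mass : Tendsto (fun p : ℝ × Vars => p.1) (𝓝 (u 7, evenVec u)) (𝓝 (u 7)) :=
    continuous_fst.tendsto _
  have tendsto_sq : Tendsto (fun p : ℝ × Vars => displacement p.2 ^ 2) (𝓝 (u 7, evenVec u))
      (𝓝 0) := by
    have continuous : Continuous fun p : ℝ × Vars => displacement p.2 ^ 2 := by fun_prop
    simpa using continuous.tendsto (u 7, evenVec u)
  have trunk_zero := tendsto_mass.eventually <|
    eventually_apply_graph_eq_zero (f := fun p => F p.1 (symVec p.2)) hψ (hψ0 ▸ hψF)
  have prongs_zero := tendsto_sq.eventually (eventually_apply_graph_eq_zero hφ (hφ0 ▸ hφF))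
  filter_upwards [eventually_eq_symVec hu hu0 hψF, eventually_eq_displaced hu hu0 hφF, trunk_zero,
    prongs_zero] with ⟨m, x⟩ on_trunk on_prongs trunk_zero prongs_zero
  refine ⟨fun hF => ?_, ?_⟩
  · by_cases hy : displacement x = 0
    · exact Or.inl (on_trunk hF hy)
    · exact Or.inr (on_prongs hF hy)
  · rintro (hx | ⟨hx, hm⟩)
    · exact hx ▸ trunk_zero
    · simp only at hx hm prongs_zero ⊢
      rw [hx, hm, F_displaced, prongs_zero, map_zero, map_zero, smul_zero, add_zero]

theorem isSupercriticalPitchfork_F (hu : u ∈ approxBall (10 ^ 10)) (hu0 : blowUp (0, u) = 0) :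
    IsSupercriticalPitchfork F (u 7) (evenVec u) := by
  have hu' := approxBall_mono (by norm_num : (10 ^ 10 : ℤ) ≤ 10 ^ 40) hu
  obtain ⟨ψ, hψ, hψ0, hψF⟩ := exists_symmetric_branch hu' hu0
  obtain ⟨φ, hφ, hφ0, hφF⟩ := exists_asymmetric_branch hu' hu0
  have smooth_sq : ∀ᶠ y in 𝓝 (0 : ℝ), ContDiffAt ℝ ∞ (fun y => φ (y ^ 2)) y := by
    have tendsto_sq : Tendsto (fun y : ℝ => y ^ 2) (𝓝 0) (𝓝 0) := by
      simpa using (continuous_pow 2).tendsto (0 : ℝ)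
    exact (tendsto_sq.eventually (hφ.eventually (by simp))).mono fun y hy =>
      (hy.comp y (f := fun y => y ^ 2) (contDiffAt_id.pow 2)).of_le le_top
  have smooth_apply (i : Fin 8) : ContDiff ℝ ∞ fun u : Vars => u i := contDiff_apply ℝ ℝ i
  have mass_pos := deriv_mass_pos hu (hφ.differentiableAt (by simp)) hφ0
    (eventually_apply_graph_eq_zero hφ.continuousAt (hφ0 ▸ hφF))
  have mass_analytic : AnalyticAt ℝ (fun t => φ t 7) 0 :=
    ((contDiff_apply ℝ ℝ (7 : Fin 8)).contDiffAt.comp 0 hφ).analyticAt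
  refine isSupercriticalPitchfork_of_branches displacement (s := fun m => symVec (ψ m))
    (X := fun y => displaced (φ (y ^ 2)) y) (T := fun y => φ (y ^ 2) 7)
    ?_ (by rw [hψ0, evenVec_apply]) ?_ (by simp [hφ0, displaced_zero]) ?_ (by simp [hφ0])
    (by simp) ?_ (by simp) (by simp)
    (eventually_F_eq_zero_iff hu' hu0 hψ.continuousAt hψ0 hψF hφ.continuousAt hφ0 hφF)
  · exact (hψ.eventually (by simp)).mono fun m hm =>
      (symVec.contDiff.contDiffAt.comp m hm).of_le le_top
  · exact smooth_sq.mono fun y hy => (evenVec.contDiff.contDiffAt.comp y hy).add <|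
      contDiffAt_id.smul <| antiVec.contDiff.contDiffAt.comp y <|
        ((smooth_apply 6).contDiffAt.comp y hy).prodMk contDiffAt_const
  · exact smooth_sq.mono fun y hy => (smooth_apply 7).contDiffAt.comp y hy
  · have second_deriv := deriv_deriv_comp_sq_add_smul_comp_sq (k := fun _ => (0 : ℝ))
      mass_analytic analyticAt_const
    simp only [smul_eq_mul, mul_zero, add_zero] at second_deriv
    exact second_deriv ▸ mul_pos two_pos mass_pos

end Dziobek

open Dziobek Matrix in
theorem mainTheorem5 :
    ∃ (m : ℝ) (x : Vars),
      -- the bifurcation point: existence and uniqueness in the box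
      InBox m x ∧ IsSymmetricSingularSolution m x ∧
      (∀ (m' : ℝ) (x' : Vars), InBox m' x' → IsSymmetricSingularSolution m' x' →
        m' = m ∧ x' = x) ∧
      -- zero is a simple eigenvalue of the Jacobian matrix
      (jacobian m x).charpoly.rootMultiplicity 0 = 1 ∧
      ∃ v w : Fin 8 → ℝ,
        -- `v` spans the kernel, is antisymmetric, and is normalized
        LinearMap.ker (jacobian m x).mulVecLin = Submodule.span ℝ {v} ∧
        swap12 v = -v ∧ v 6 = 1 ∧ |v 3 - 0.3503863414744728128369| ≤ 1 / 10 ^ 22 ∧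
        -- `w` spans the kernel of the transpose, and is normalized
        LinearMap.ker (jacobian m x)ᵀ.mulVecLin = Submodule.span ℝ {w} ∧
        swap12 w = -w ∧ w 6 = 1 ∧ |w 3 - 1.0453646029495395551308| ≤ 1 / 10 ^ 22 ∧
        -- the conditions on the derivatives
        w ⬝ᵥ paramDeriv m x = 0 ∧
        w ⬝ᵥ fderiv ℝ (paramDeriv m) x v ≠ 0 ∧
        |w ⬝ᵥ fderiv ℝ (paramDeriv m) x v - 27.1877227151147526097| ≤ 1 / 10 ^ 19 ∧
        w ⬝ᵥ iteratedFDeriv ℝ 2 (F m) x ![v, v] = 0 ∧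
        w ⬝ᵥ iteratedFDeriv ℝ 3 (F m) x ![v, v, v] < 0 ∧
        |w ⬝ᵥ iteratedFDeriv ℝ 3 (F m) x ![v, v, v] - (-2639.9736664601674948)| ≤ 1 / 10 ^ 16 ∧
        -- the bifurcation
        IsSupercriticalPitchfork F m x := by
  obtain ⟨u, hu, hu0, unique_zero⟩ := existsUnique_blowUp_zero
  have hu' := approxBall_mono (by norm_num : (10 ^ 10 : ℤ) ≤ 10 ^ 40) hu
  have ker_eq := ker_jacobian_eq_span hu' hu0
  have left_zero := antiVec_leftSlope_vecMul_jacobian hu' hu0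
  have mixed := abs_mixed_sub_le hu
  have cubic := abs_cubic_sub_le hu
  rw [← fderiv_paramDeriv_antiVec] at mixed
  rw [← iteratedFDeriv_three_F_antiVec] at cubic
  refine ⟨u 7, evenVec u, inBox_evenVec hu, isSymmetricSingularSolution hu0, fun m x hbox hx => ?_,
    rootMultiplicity_charpoly_zero_eq_one_of_dotProduct_ne_zero ker_eq left_zero
      (antiVec_leftSlope_dotProduct_antiVec_slope_ne_zero hu),
    antiVec (u 6, 1), antiVec (leftSlope u, 1), ker_eq, swap12_antiVec _, rfl, abs_slope_sub_le hu,
    ker_mulVecLin_transpose_eq_span (antiVec_one_ne_zero _) (antiVec_one_ne_zero _) ker_eq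
      (by rw [mulVec_transpose, left_zero]),
    swap12_antiVec _, rfl, abs_leftSlope_sub_le hu,
    by rw [paramDeriv_evenVec, antiVec_dotProduct_evenVec],
    fun mixed_zero => by norm_num [mixed_zero] at mixed, mixed,
    by rw [iteratedFDeriv_two_F_antiVec, dotProduct_smul, antiVec_dotProduct_evenVec, smul_zero],
    by linarith [(abs_le.1 cubic).2], cubic, isSupercriticalPitchfork_F hu hu0⟩
  obtain ⟨u', hu', hu'0, rfl, rfl⟩ := exists_blowUp_zero_of_isSymmetricSingularSolution hbox hx
  rw [unique_zero u' hu' hu'0]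
  exact ⟨rfl, rfl⟩
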